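/- **$k$-sparse $\mathcal H_\infty$ synthesis via two SDPs.** All matrices below have entries in $\mathbb F$, where $\mathbb F=\mathbb R$ or $\mathbb F=\mathbb C$, unless said otherwise; $X\succ 0$ means Hermitian positive definite. Consider the plant $$x_{j+1}=Ax_j+B_1w_j+B_2u_j,\quad z_j=C_1x_j+D_{11}w_j+D_{12}u_j,\quad y_j=C_2x_j+D_{21}w_j$$ with $x_j\in\mathbb F^n$, $w_j\in\mathbb F^m$, and controllers $K=(A_K,B_K,C_K,D_K)$ of order $n_K\ge n$, $$\zeta_{j+1}=A_K\zeta_j+B_Ky_j,\qquad u_j=C_K\zeta_j+D_Ky_j .$$ The closed loop $\mathcal M_K$ has the matrices $$A_{cl}=\begin{bmatrix}A+B_2D_KC_2&B_2C_K\\B_KC_2&A_K\end{bmatrix},\ B_{cl}=\begin{bmatrix}B_1+B_2D_KD_{21}\\B_KD_{21}\end{bmatrix},\ C_{cl}=\begin{bmatrix}C_1+D_{12}D_KC_2&D_{12}C_K\end{bmatrix},\ D_{cl}=D_{11}+D_{12}D_KD_{21}.$$ $K$ is stabilizing if $\rho(A_{cl})<1$. Assume that the plant is stabilizable, i.e. some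 controller of some order is stabilizing. For an integer $k\ge0$ and a system $\mathcal M=(A,B,C,D)$ let the relaxed $k$-sparse $\mathcal H_\infty$ norm $\bar\mu^{sdp}_k(\mathcal M)\ge 0$ be given by $$\bar\mu^{sdp}_k(\mathcal M)^2=\sup\operatorname{Tr}\left(\begin{bmatrix}C^*C&C^*D\\D^*C&D^*D\end{bmatrix}V\right)$$ over complex $V=\begin{bmatrix}X&R\\R^*&W\end{bmatrix}\succeq0$ with $X=\begin{bmatrix}A&B\end{bmatrix}V\begin{bmatrix}A^*\\B^*\end{bmatrix}$, $\operatorname{Tr}W\le1$, $\sum_{i,j}|W_{ij}|\le k$. Say that $(Y,\lambda,t)$ is admissible if $Y=Y^*\in\mathbb F^{m\times m}$, $|Y_{ij}|\le t$ for all $i,j$ (that is, $|Y|\le t\mathbf 1\mathbf 1^{\top}$), $t\ge0$, $\lambda\ge0$. *Synthesis problem (S).* Minimize $\lambda+kt$ over $K$, $P_{cl}\succ0$ and admissible $(Y,\lambda,t)$ with $$\begin{bmatrix}A_{cl}^*P_{cl}A_{cl}-P_{cl}&A_{cl}^*P_{cl}B_{cl}\\B_{cl}^*P_{cl}A_{cl}&B_{cl}^*P_{cl}B_{cl}-\lambda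 I-Y\end{bmatrix}+\begin{bmatrix}C_{cl}^*C_{cl}&C_{cl}^*D_{cl}\\D_{cl}^*C_{cl}&D_{cl}^*D_{cl}\end{bmatrix}\prec0.$$ *First SDP (SDP1).* Let $N_c$, $N_o$ be any matrices with orthonormal columns spanning $\ker\begin{bmatrix}B_2^*&D_{12}^*\end{bmatrix}$ and $\ker\begin{bmatrix}C_2&D_{21}\end{bmatrix}$, and let $\Pi_c=\begin{bmatrix}N_c&0\\0&I\end{bmatrix}$, $\Pi_o=\begin{bmatrix}N_o&0\\0&I\end{bmatrix}$. Minimize $\lambda+kt$ over $P,Q$ and admissible $(Y,\lambda,t)$ with $\begin{bmatrix}P&I\\I&Q\end{bmatrix}\succ0$, $$\Pi_c^*\begin{bmatrix}AQA^*-Q&AQC_1^*&B_1\\C_1QA^*&C_1QC_1^*-I&D_{11}\\B_1^*&D_{11}^*&-\lambda I-Y\end{bmatrix}\Pi_c\prec0,\qquad\Pi_o^*\begin{bmatrix}A^*PA-P&A^*PB_1&C_1^*\\B_1^*PA&B_1^*PB_1-\lambda I-Y&D_{11}^*\\C_1&D_{11}&-I\end{bmatrix}\Pi_o\prec0.$$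 *Second SDP (SDP2), for a fixed $P_{cl}$.* Minimize $\lambda+kt$ over $K$ and admissible $(Y,\lambda,t)$ with $$\begin{bmatrix}P_{cl}^{-1}&0&A_{cl}&B_{cl}\\0&I&C_{cl}&D_{cl}\\A_{cl}^*&C_{cl}^*&P_{cl}&0\\B_{cl}^*&D_{cl}^*&0&\lambda I+Y\end{bmatrix}\succ0.$$ Then the following hold. 1. For every stabilizing $K$ of order $n_K$ the supremum defining $\bar\mu^{sdp}_k(\mathcal M_K)^2$ is finite. 2. A triple $(Y,\lambda,t)$ extends to a feasible point of (S) if and only if it extends to a feasible point of (SDP1). 3. There is a real number $\gamma$ such that $\inf\{\bar\mu^{sdp}_k(\mathcal M_K)^2: K\text{ stabilizing of order }n_K\}=\gamma$ and the optimal values (infima) of (S) and of (SDP1) are both $\gamma$; all three problems are feasible. 4. Let $(P,Q,Y,\lambda,t)$ be feasible for (SDP1). There is $P_2\in\mathbb F^{n_K\times n}$ with $P-Q^{-1}=P_2^*P_2$. For every such $P_2$ the matrix $P_{cl}=\begin{bmatrix}P&P_2^*\\P_2&I\end{bmatrix}$ is positive definite, and (SDP2) with this $P_{cl}$ is feasible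 with the same $(Y,\lambda,t)$ and some $K$; its optimal value $\delta$ satisfies $\gamma\le\delta\le\lambda+kt$. For every feasible point $(K,Y',\lambda',t')$ of (SDP2) with this $P_{cl}$, the controller $K$ is stabilizing, $(K,P_{cl},Y',\lambda',t')$ is feasible for (S), and $\bar\mu^{sdp}_k(\mathcal M_K)^2\le\lambda'+kt'$. -/

import Mathlib

open scoped ComplexOrder Matrix

noncomputable section

/-- State-space data of `x⁺ = A x + B w`, `z = C x + D w`. -/
structure StateSpace (𝕜 n m p : Type*) where
  A : Matrix n n 𝕜
  B : Matrix n m 𝕜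
  C : Matrix p n 𝕜
  D : Matrix p m 𝕜

/-- State-space data of the plant `x⁺ = A x + B₁ w + B₂ u`, `z = C₁ x + D₁₁ w + D₁₂ u`,
`y = C₂ x + D₂₁ w`, with state index `n`, disturbance index `m`, control index `r`,
regulated output index `p` and measurement index `q`. -/
structure Plant (𝕜 n m r p q : Type*) where
  A : Matrix n n 𝕜
  B₁ : Matrix n m 𝕜
  B₂ : Matrix n r 𝕜
  C₁ : Matrix p n 𝕜
  D₁₁ : Matrix p m 𝕜
  D₁₂ : Matrix p r 𝕜
  C₂ : Matrix q n 𝕜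
  D₂₁ : Matrix q m 𝕜

/-- Dynamic output-feedback controller `ζ⁺ = A_K ζ + B_K y`, `u = C_K ζ + D_K y` with
controller state index `ν`. -/
structure Controller (𝕜 ν r q : Type*) where
  AK : Matrix ν ν 𝕜
  BK : Matrix ν q 𝕜
  CK : Matrix r ν 𝕜
  DK : Matrix r q 𝕜

variable {𝕜 : Type*} [RCLike 𝕜]
variable {n ν m r p q c : Type*}
variable [Fintype n] [Fintype ν] [Fintype m] [Fintype r] [Fintype p] [Fintype q]
variable [DecidableEq n] [DecidableEq ν] [DecidableEq m] [DecidableEq p]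

/-- A real or complex matrix, seen as a complex matrix. -/
def toComplexMatrix {a b : Type*} (M : Matrix a b 𝕜) : Matrix a b ℂ :=
  M.map (RCLike.map 𝕜 ℂ)

/-- A real or complex system, seen as a complex system. -/
def StateSpace.toComplex (M : StateSpace 𝕜 n m p) : StateSpace ℂ n m p where
  A := toComplexMatrix M.A
  B := toComplexMatrix M.B
  C := toComplexMatrix M.C
  D := toComplexMatrix M.D

/-- Discrete-time stability `ρ(A) < 1`; the spectrum is the complex one also for real `A`. -/
def IsSchurStable (A : Matrix n n 𝕜) : Prop :=
  spectralRadius ℂ (toComplexMatrix A) < 1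

/-! ### The relaxed `k`-sparse norm -/

/-- The constraints of the semidefinite relaxation, on the blocks of `V = [X R; Rᴴ W]`. -/
structure RelaxationFeasible (M : StateSpace ℂ n m p) (k : ℕ)
    (X : Matrix n n ℂ) (R : Matrix n m ℂ) (W : Matrix m m ℂ) : Prop where
  stationary : X = Matrix.fromCols M.A M.B * Matrix.fromBlocks X R Rᴴ W *
    Matrix.fromRows M.Aᴴ M.Bᴴ
  trace_le : W.trace.re ≤ 1
  sum_norm_le : ∑ i, ∑ j, ‖W i j‖ ≤ (k : ℝ)
  posSemidef : (Matrix.fromBlocks X R Rᴴ W).PosSemidef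

/-- The objective `Tr ([CᴴC CᴴD; DᴴC DᴴD] V)` of the semidefinite relaxation. -/
def relaxationObjective (M : StateSpace ℂ n m p)
    (X : Matrix n n ℂ) (R : Matrix n m ℂ) (W : Matrix m m ℂ) : ℝ :=
  (Matrix.fromBlocks (M.Cᴴ * M.C) (M.Cᴴ * M.D) (M.Dᴴ * M.C) (M.Dᴴ * M.D) *
    Matrix.fromBlocks X R Rᴴ W).trace.re

/-- The values of the objective of the semidefinite relaxation at feasible points. -/
def relaxationValues (M : StateSpace 𝕜 n m p) (k : ℕ) : Set ℝ :=
  {v | ∃ X R W, RelaxationFeasible M.toComplex k X R W ∧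
    v = relaxationObjective M.toComplex X R W}

/-- The relaxed `k`-sparse `H∞` norm: its square is the optimal value of the relaxation. -/
def relaxedNorm (M : StateSpace 𝕜 n m p) (k : ℕ) : ℝ :=
  √(sSup (relaxationValues M k))

/-! ### Closed loop -/

/-- The interconnection of plant and controller, with state `(x, ζ)`. -/
def closedLoop (G : Plant 𝕜 n m r p q) (K : Controller 𝕜 ν r q) :
    StateSpace 𝕜 (n ⊕ ν) m p where
  A := Matrix.fromBlocks (G.A + G.B₂ * K.DK * G.C₂) (G.B₂ * K.CK) (K.BK * G.C₂) K.AK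
  B := Matrix.fromRows (G.B₁ + G.B₂ * K.DK * G.D₂₁) (K.BK * G.D₂₁)
  C := Matrix.fromCols (G.C₁ + G.D₁₂ * K.DK * G.C₂) (G.D₁₂ * K.CK)
  D := G.D₁₁ + G.D₁₂ * K.DK * G.D₂₁

/-- The controller makes the closed loop stable. -/
def Stabilizes (G : Plant 𝕜 n m r p q) (K : Controller 𝕜 ν r q) : Prop :=
  IsSchurStable (closedLoop G K).A

/-- Some dynamic output-feedback controller, of some order, stabilizes the plant. -/
def IsStabilizable (G : Plant 𝕜 n m r p q) : Prop :=
  ∃ (d : ℕ) (K : Controller 𝕜 (Fin d) r q), Stabilizes G K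

/-! ### The optimization problems

All of them have the objective `λ + k t`; strict matrix inequalities `M ≺ 0` are written
`(-M).PosDef`. -/

/-- The constraints shared by all problems: `|Y| ≤ t 11ᵀ`, `Y = Yᴴ`, `t ≥ 0`, `λ ≥ 0`. -/
structure SparsityConstraints (Y : Matrix m m 𝕜) (lam t : ℝ) : Prop where
  abs_le : ∀ i j, ‖Y i j‖ ≤ t
  isHermitian : Y.IsHermitian
  t_nonneg : 0 ≤ t
  lam_nonneg : 0 ≤ lam

/-- The synthesis problem (a bilinear matrix inequality). -/
structure SynthesisFeasible (G : Plant 𝕜 n m r p q) (K : Controller 𝕜 ν r q)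
    (Pcl : Matrix (n ⊕ ν) (n ⊕ ν) 𝕜) (Y : Matrix m m 𝕜) (lam t : ℝ) : Prop where
  sparsity : SparsityConstraints Y lam t
  Pcl_posDef : Pcl.PosDef
  lmi : let S := closedLoop G K
    (-(Matrix.fromBlocks
        (S.Aᴴ * Pcl * S.A - Pcl) (S.Aᴴ * Pcl * S.B)
        (S.Bᴴ * Pcl * S.A) (S.Bᴴ * Pcl * S.B - lam • (1 : Matrix m m 𝕜) - Y) +
      Matrix.fromBlocks
        (S.Cᴴ * S.C) (S.Cᴴ * S.D)
        (S.Dᴴ * S.C) (S.Dᴴ * S.D))).PosDef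

/-- `N` has orthonormal columns that span the kernel of `M`. -/
structure IsOrthonormalKernelBasis {a b : Type*} [Fintype a] [DecidableEq c] [Fintype c]
    (M : Matrix b a 𝕜) (N : Matrix a c 𝕜) : Prop where
  range_eq_ker : LinearMap.range N.mulVecLin = LinearMap.ker M.mulVecLin
  orthonormal : Nᴴ * N = 1

/-- The first semidefinite program, in the variables `P, Q, Y, λ, t`. The columns of `Nc` span
the kernel of `[B₂ᴴ D₁₂ᴴ]` and those of `No` the kernel of `[C₂ D₂₁]`. -/
structure PQFeasible {cc co : Type*} [Fintype cc] [Fintype co]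
    (G : Plant 𝕜 n m r p q) (Nc : Matrix (n ⊕ p) cc 𝕜) (No : Matrix (n ⊕ m) co 𝕜)
    (P Q : Matrix n n 𝕜) (Y : Matrix m m 𝕜) (lam t : ℝ) : Prop where
  sparsity : SparsityConstraints Y lam t
  coupling : (Matrix.fromBlocks P 1 1 Q).PosDef
  control_lmi :
    let Pic : Matrix ((n ⊕ p) ⊕ m) (cc ⊕ m) 𝕜 := Matrix.fromBlocks Nc 0 0 1
    (-(Picᴴ * Matrix.fromBlocks
      (Matrix.fromBlocks
        (G.A * Q * G.Aᴴ - Q) (G.A * Q * G.C₁ᴴ)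
        (G.C₁ * Q * G.Aᴴ) (G.C₁ * Q * G.C₁ᴴ - 1))
      (Matrix.fromRows G.B₁ G.D₁₁)
      (Matrix.fromCols G.B₁ᴴ G.D₁₁ᴴ)
      (-(lam • (1 : Matrix m m 𝕜)) - Y) * Pic)).PosDef
  observe_lmi :
    let Pio : Matrix ((n ⊕ m) ⊕ p) (co ⊕ p) 𝕜 := Matrix.fromBlocks No 0 0 1
    (-(Pioᴴ * Matrix.fromBlocks
      (Matrix.fromBlocks
        (G.Aᴴ * P * G.A - P) (G.Aᴴ * P * G.B₁)
        (G.B₁ᴴ * P * G.A) (G.B₁ᴴ * P * G.B₁ - lam • (1 : Matrix m m 𝕜) - Y))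
      (Matrix.fromRows G.C₁ᴴ G.D₁₁ᴴ)
      (Matrix.fromCols G.C₁ G.D₁₁)
      (-1) * Pio)).PosDef

/-- The matrix `P_cl = [P P₂ᴴ; P₂ I]`. -/
def reconstructedPcl (P : Matrix n n 𝕜) (P₂ : Matrix ν n 𝕜) :
    Matrix (n ⊕ ν) (n ⊕ ν) 𝕜 :=
  Matrix.fromBlocks P P₂ᴴ P₂ 1

/-- The second semidefinite program, in the variables `A_K, B_K, C_K, D_K, Y, λ, t`, for a
fixed matrix `P_cl`. -/
structure ConstructionFeasible (G : Plant 𝕜 n m r p q) (Pcl : Matrix (n ⊕ ν) (n ⊕ ν) 𝕜)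
    (K : Controller 𝕜 ν r q) (Y : Matrix m m 𝕜) (lam t : ℝ) : Prop where
  sparsity : SparsityConstraints Y lam t
  lmi : let S := closedLoop G K
    (Matrix.fromBlocks
      (Matrix.fromBlocks Pcl⁻¹ 0 0 (1 : Matrix p p 𝕜))
      (Matrix.fromBlocks S.A S.B S.C S.D)
      (Matrix.fromBlocks S.Aᴴ S.Cᴴ S.Bᴴ S.Dᴴ)
      (Matrix.fromBlocks Pcl 0 0 (lam • (1 : Matrix m m 𝕜) + Y))).PosDef

end

/-! Two facts carry the theorem: the relaxation and the dissipation inequality are dual semidefinite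
programs, and the controller can be eliminated from the dissipation inequality without changing the
feasible `(Y, λ, t)`. Both rest on one theorem of alternatives,
`exists_posSemidef_of_forall_not_posDef`: a nonempty convex set of Hermitian matrices that misses
the positive definite cone is separated from it by a nonzero positive semidefinite matrix.

Duality. Pairing a feasible `V` with the dissipation matrix in the trace gives weak duality
(`relaxationValues_le`). Conversely, if no certificate has cost below `β`, the separating matrix
satisfies the homogenized constraints of the relaxation and, once scaled, is a feasible `V` of value
at least `β` (`IsSchurStable.exists_posDef_dissipation_of_lt`). The degenerate multiplier, where the
scale is zero, is excluded by stability: then `W = 0`, hence `R = 0`, hence `X = A X Aᴴ`, hence `X =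
0`. The separation takes place over `𝕜` while the relaxation is complex; a `V` over `𝕜` is also a
complex one, so real certificates suffice for real data. Lyapunov arguments link positive
definiteness of `P` to stability in both directions.

Elimination. By a Schur complement, the dissipation inequality for the closed loop says that a
matrix affine in the controller parameters is positive definite (`posDef_constructionMatrix_iff`).
The projection lemma `Matrix.exists_posDef_add_mul_mul` makes it solvable for the controller exactly
when its form is positive on two kernels. Minimizing out the closed-loop state or costate there
leaves the two inequalities of the first program, with `P` and `Q` the leading blocks of `P_cl` and
of its inverse. Conversely, `P - Q⁻¹ = P₂ᴴ P₂` yields a `P_cl` with exactly these leading blocks,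
and a factor `P₂` with `nK` rows exists because `n ≤ nK`.

Elimination accepts controllers of any order, and reconstruction returns order `nK`. A stabilizing
controller of unspecified order therefore already gives feasibility of all the problems, and their
values agree. -/

open scoped ComplexOrder Matrix

set_option linter.unusedSectionVars false

noncomputable section

/-! ### The real inner product on vectors over `𝕜` and quadratic forms -/

section QuadraticForms

variable {𝕜 : Type*} [RCLike 𝕜] {ι κ μ : Type*} [Fintype ι] [Fintype κ] [Fintype μ]

/-- The real inner product `Re (xᴴ y)`. -/
def reDot (x y : ι → 𝕜) : ℝ := RCLike.re (star x ⬝ᵥ y)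

theorem reDot_add_left (x y z : ι → 𝕜) : reDot (x + y) z = reDot x z + reDot y z := by
  simp [reDot, add_dotProduct]

theorem reDot_add_right (x y z : ι → 𝕜) : reDot x (y + z) = reDot x y + reDot x z := by
  simp [reDot, dotProduct_add]

theorem reDot_neg_left (x y : ι → 𝕜) : reDot (-x) y = -reDot x y := by
  simp [reDot, neg_dotProduct]

theorem reDot_neg_right (x y : ι → 𝕜) : reDot x (-y) = -reDot x y := by
  simp [reDot, dotProduct_neg]

theorem reDot_sub_right (x y z : ι → 𝕜) : reDot x (y - z) = reDot x y - reDot x z := by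
  simp [reDot, dotProduct_sub]

@[simp] theorem reDot_zero_left (x : ι → 𝕜) : reDot 0 x = 0 := by simp [reDot]

@[simp] theorem reDot_zero_right (x : ι → 𝕜) : reDot x 0 = 0 := by simp [reDot]

theorem reDot_smul_right (c : ℝ) (x y : ι → 𝕜) : reDot x (c • y) = c * reDot x y := by
  simp [reDot, RCLike.smul_re]

theorem reDot_comm (x y : ι → 𝕜) : reDot x y = reDot y x := by
  unfold reDot
  rw [← RCLike.conj_re (star x ⬝ᵥ y), starRingEnd_apply, ← Matrix.star_dotProduct_star,
    star_star, dotProduct_comm, dotProduct_comm]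

theorem reDot_smul_left (c : ℝ) (x y : ι → 𝕜) : reDot (c • x) y = c * reDot x y := by
  rw [reDot_comm, reDot_smul_right, reDot_comm]

theorem reDot_mulVec (x : ι → 𝕜) (M : Matrix ι κ 𝕜) (y : κ → 𝕜) :
    reDot x (M *ᵥ y) = reDot (Mᴴ *ᵥ x) y := by
  unfold reDot
  rw [Matrix.dotProduct_mulVec, Matrix.star_mulVec, Matrix.conjTranspose_conjTranspose]

theorem reDot_elim (a c : ι → 𝕜) (b d : κ → 𝕜) :
    reDot (Sum.elim a b) (Sum.elim c d) = reDot a c + reDot b d := by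
  simp [reDot, dotProduct, Fintype.sum_sum_type]

theorem reDot_self (x : ι → 𝕜) : reDot x x = ∑ i, ‖x i‖ ^ 2 := by
  rw [reDot, dotProduct, map_sum]
  refine Finset.sum_congr rfl fun i _ => ?_
  rw [Pi.star_apply, ← starRingEnd_apply, RCLike.conj_mul, ← RCLike.ofReal_pow, RCLike.ofReal_re]

theorem reDot_self_nonneg (x : ι → 𝕜) : 0 ≤ reDot x x := by
  rw [reDot_self]; positivity

theorem reDot_self_pos {x : ι → 𝕜} (hx : x ≠ 0) : 0 < reDot x x := by
  obtain ⟨i, hi⟩ := Function.ne_iff.1 hx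
  rw [reDot_self]
  exact Finset.sum_pos' (fun _ _ => by positivity)
    ⟨i, Finset.mem_univ _, by have : 0 < ‖x i‖ := norm_pos_iff.2 hi; positivity⟩

theorem reDot_mulVec_add (M N : Matrix ι κ 𝕜) (x : ι → 𝕜) (y : κ → 𝕜) :
    reDot x ((M + N) *ᵥ y) = reDot x (M *ᵥ y) + reDot x (N *ᵥ y) := by
  rw [Matrix.add_mulVec, reDot_add_right]

theorem reDot_mulVec_sub (M N : Matrix ι κ 𝕜) (x : ι → 𝕜) (y : κ → 𝕜) :
    reDot x ((M - N) *ᵥ y) = reDot x (M *ᵥ y) - reDot x (N *ᵥ y) := by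
  rw [Matrix.sub_mulVec, reDot_sub_right]

theorem reDot_mulVec_neg (M : Matrix ι κ 𝕜) (x : ι → 𝕜) (y : κ → 𝕜) :
    reDot x ((-M) *ᵥ y) = -reDot x (M *ᵥ y) := by
  rw [Matrix.neg_mulVec, reDot_neg_right]

theorem reDot_mulVec_smul (c : ℝ) (M : Matrix ι κ 𝕜) (x : ι → 𝕜) (y : κ → 𝕜) :
    reDot x ((c • M) *ᵥ y) = c * reDot x (M *ᵥ y) := by
  rw [Matrix.smul_mulVec, reDot_smul_right]

theorem reDot_conj_mulVec (G : Matrix ι κ 𝕜) (M : Matrix ι ι 𝕜) (x : κ → 𝕜) :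
    reDot x ((Gᴴ * M * G) *ᵥ x) = reDot (G *ᵥ x) (M *ᵥ (G *ᵥ x)) := by
  rw [← Matrix.mulVec_mulVec, ← Matrix.mulVec_mulVec, reDot_mulVec,
    Matrix.conjTranspose_conjTranspose]

theorem im_star_dotProduct_mulVec {M : Matrix ι ι 𝕜} (hM : M.IsHermitian) (x : ι → 𝕜) :
    RCLike.im (star x ⬝ᵥ M *ᵥ x) = 0 := by
  rw [← RCLike.conj_eq_iff_im, starRingEnd_apply, ← Matrix.star_dotProduct_star, star_star,
    Matrix.star_mulVec, hM.eq, dotProduct_comm, Matrix.dotProduct_mulVec, dotProduct_comm,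
    dotProduct_comm]

theorem posDef_iff_reDot {M : Matrix ι ι 𝕜} :
    M.PosDef ↔ M.IsHermitian ∧ ∀ x, x ≠ 0 → 0 < reDot x (M *ᵥ x) := by
  rw [Matrix.posDef_iff_dotProduct_mulVec]
  refine and_congr_right fun hM => forall₂_congr fun x _ => ?_
  rw [RCLike.pos_iff, im_star_dotProduct_mulVec hM x, reDot, and_iff_left rfl]

theorem posSemidef_iff_reDot {M : Matrix ι ι 𝕜} :
    M.PosSemidef ↔ M.IsHermitian ∧ ∀ x, 0 ≤ reDot x (M *ᵥ x) := by
  rw [Matrix.posSemidef_iff_dotProduct_mulVec]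
  refine and_congr_right fun hM => forall_congr' fun x => ?_
  rw [RCLike.nonneg_iff, im_star_dotProduct_mulVec hM x, reDot, and_iff_left rfl]

theorem Matrix.PosDef.reDot_pos {M : Matrix ι ι 𝕜} (hM : M.PosDef) {x : ι → 𝕜} (hx : x ≠ 0) :
    0 < reDot x (M *ᵥ x) := (posDef_iff_reDot.1 hM).2 x hx

theorem Matrix.PosSemidef.reDot_nonneg {M : Matrix ι ι 𝕜} (hM : M.PosSemidef) (x : ι → 𝕜) :
    0 ≤ reDot x (M *ᵥ x) := (posSemidef_iff_reDot.1 hM).2 x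

/-- Completing the square. -/
theorem Matrix.PosDef.reDot_complete_square [DecidableEq ι] {M : Matrix ι ι 𝕜} (hM : M.PosDef)
    (x y : ι → 𝕜) :
    reDot x (M *ᵥ x) + 2 * reDot y x =
      reDot (x + M⁻¹ *ᵥ y) (M *ᵥ (x + M⁻¹ *ᵥ y)) - reDot y (M⁻¹ *ᵥ y) := by
  have h : M *ᵥ (M⁻¹ *ᵥ y) = y := by
    rw [Matrix.mulVec_mulVec,
      Matrix.mul_nonsing_inv _ ((Matrix.isUnit_iff_isUnit_det _).1 hM.isUnit), Matrix.one_mulVec]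
  have h' : reDot (M⁻¹ *ᵥ y) (M *ᵥ x) = reDot y x := by
    rw [reDot_mulVec, hM.isHermitian.eq, h]
  rw [Matrix.mulVec_add, h, reDot_add_left, reDot_add_right, reDot_add_right, h',
    reDot_comm x y, reDot_comm (M⁻¹ *ᵥ y) y]
  ring

theorem Matrix.PosDef.mulVec_inv_mulVec [DecidableEq ι] {M : Matrix ι ι 𝕜} (hM : M.PosDef)
    (x : ι → 𝕜) : M *ᵥ (M⁻¹ *ᵥ x) = x := by
  rw [Matrix.mulVec_mulVec, Matrix.mul_nonsing_inv _ ((Matrix.isUnit_iff_isUnit_det _).1 hM.isUnit),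
    Matrix.one_mulVec]

theorem Matrix.PosDef.inv_inv [DecidableEq ι] {M : Matrix ι ι 𝕜} (hM : M.PosDef) :
    M⁻¹⁻¹ = M :=
  Matrix.nonsing_inv_nonsing_inv _ ((Matrix.isUnit_iff_isUnit_det _).1 hM.isUnit)

theorem re_trace_conj (F : Matrix ι κ 𝕜) (M : Matrix ι ι 𝕜) :
    RCLike.re (Matrix.trace (Fᴴ * M * F)) = ∑ j, reDot (F.col j) (M *ᵥ F.col j) := by
  simp only [Matrix.trace, map_sum, Matrix.diag_apply]
  refine Finset.sum_congr rfl fun j _ => ?_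
  rw [Matrix.mul_assoc]
  rfl

open scoped MatrixOrder in
theorem Matrix.PosSemidef.exists_eq_conjTranspose_mul_self {Z : Matrix ι ι 𝕜}
    (hZ : Z.PosSemidef) : ∃ B : Matrix ι ι 𝕜, Z = Bᴴ * B := by
  classical
  exact CStarAlgebra.nonneg_iff_eq_star_mul_self.mp hZ.nonneg

/-- With `Z = Bᴴ B`, the trace is the sum of the form of `M` over the columns of `Bᴴ`. -/
theorem Matrix.PosSemidef.re_trace_mul_nonneg {Z M : Matrix ι ι 𝕜} (hZ : Z.PosSemidef)
    (hM : M.PosSemidef) : 0 ≤ RCLike.re (Z * M).trace := by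
  classical
  obtain ⟨B, rfl⟩ := hZ.exists_eq_conjTranspose_mul_self
  rw [Matrix.mul_assoc, Matrix.trace_mul_comm]
  have := re_trace_conj Bᴴ M
  rw [Matrix.conjTranspose_conjTranspose] at this
  rw [this]
  exact Finset.sum_nonneg fun j _ => hM.reDot_nonneg _

theorem Matrix.PosSemidef.eq_zero_of_re_trace_mul_nonpos {Z M : Matrix ι ι 𝕜}
    (hZ : Z.PosSemidef) (hM : M.PosDef) (h : RCLike.re (Z * M).trace ≤ 0) : Z = 0 := by
  classical
  obtain ⟨B, rfl⟩ := hZ.exists_eq_conjTranspose_mul_self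
  rw [Matrix.mul_assoc, Matrix.trace_mul_comm] at h
  have := re_trace_conj Bᴴ M
  rw [Matrix.conjTranspose_conjTranspose] at this
  rw [this] at h
  have h0 : Bᴴ = 0 := by
    have h1 := (Finset.sum_eq_zero_iff_of_nonneg
      (fun j _ => hM.posSemidef.reDot_nonneg (Bᴴ.col j))).1
      (le_antisymm h (Finset.sum_nonneg fun j _ => hM.posSemidef.reDot_nonneg _))
    ext i j
    have h2 : Bᴴ.col j = 0 := by
      by_contra hne
      exact (hM.reDot_pos hne).ne' (h1 j (Finset.mem_univ _))
    exact congrFun h2 i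
  rw [h0, Matrix.zero_mul]

/-! ### A theorem of alternatives for the positive definite cone -/

/-- By homogeneity only the unit sphere has to be tested, and its compactness makes strict
positivity stable under perturbation. -/
theorem isOpen_setOf_reDot_pos :
    IsOpen {M : Matrix ι ι 𝕜 | ∀ x, x ≠ 0 → 0 < reDot x (M *ᵥ x)} := by
  have hK : IsCompact (Metric.sphere (0 : ι → 𝕜) 1) := isCompact_sphere _ _
  have heq : {M : Matrix ι ι 𝕜 | ∀ x, x ≠ 0 → 0 < reDot x (M *ᵥ x)} =
      {M | ∀ x ∈ Metric.sphere (0 : ι → 𝕜) 1, 0 < reDot x (M *ᵥ x)} := by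
    ext M
    refine ⟨fun h x hx => h x ?_, fun h x hx => ?_⟩
    · rintro rfl; simp at hx
    · have hn : 0 < ‖x‖ := norm_pos_iff.2 hx
      have := h (‖x‖⁻¹ • x) (by simp [norm_smul, hn.ne'])
      rw [Matrix.mulVec_smul, reDot_smul_left, reDot_smul_right] at this
      have h2 : 0 < ‖x‖⁻¹ := inv_pos.2 hn
      exact pos_of_mul_pos_right (pos_of_mul_pos_right this h2.le) h2.le
  have hc : Continuous fun p : Matrix ι ι 𝕜 × (ι → 𝕜) => reDot p.2 (p.1 *ᵥ p.2) := by
    unfold reDot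
    exact RCLike.continuous_re.comp (continuous_snd.star.dotProduct
      (continuous_fst.matrix_mulVec continuous_snd))
  rw [heq, isOpen_iff_eventually]
  intro M hM
  refine hK.eventually_forall_of_forall_eventually fun x hx => ?_
  exact hc.continuousAt.eventually (lt_mem_nhds (hM x hx))

theorem re_trace_conjTranspose_mul {Z M : Matrix ι ι 𝕜} (hM : M.IsHermitian) :
    RCLike.re (Zᴴ * M).trace = RCLike.re (Z * M).trace := by
  rw [← RCLike.conj_re (Z * M).trace, starRingEnd_apply, ← Matrix.trace_conjTranspose,
    Matrix.conjTranspose_mul, hM.eq, Matrix.trace_mul_comm]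

/-- Hahn–Banach separation from an open convex cone; the separating functional is nonpositive on the
cone, so its negative is represented in the trace pairing by a positive semidefinite matrix. -/
theorem exists_posSemidef_of_forall_not_posDef {S : Set (Matrix ι ι 𝕜)} (hne : S.Nonempty)
    (hconv : Convex ℝ S) (hherm : ∀ M ∈ S, M.IsHermitian) (hS : ∀ M ∈ S, ¬ M.PosDef) :
    ∃ Z : Matrix ι ι 𝕜, Z.PosSemidef ∧ Z ≠ 0 ∧ ∀ M ∈ S, RCLike.re (Z * M).trace ≤ 0 := by
  classical
  -- Hermitian symmetry is dropped on purpose: this makes the cone open in the full matrix space,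
  -- and it still meets Hermitian matrices exactly in the positive definite ones.
  set Ω : Set (Matrix ι ι 𝕜) := {M | ∀ x, x ≠ 0 → 0 < reDot x (M *ᵥ x)} with hΩ
  have hΩc : Convex ℝ Ω := by
    intro M hM N hN a b ha hb hab x hx
    rw [reDot_mulVec_add, reDot_mulVec_smul, reDot_mulVec_smul]
    have h1 := hM x hx
    have h2 := hN x hx
    rcases ha.eq_or_lt with rfl | ha
    · rw [zero_add] at hab; subst hab; simpa using h2
    · have := mul_pos ha h1
      have := mul_nonneg hb h2.le
      linarith
  have hdisj : Disjoint Ω S := Set.disjoint_left.2 fun M hM hMS =>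
    hS M hMS (posDef_iff_reDot.2 ⟨hherm M hMS, hM⟩)
  obtain ⟨f, u, hfΩ, hfS⟩ := RCLike.geometric_hahn_banach_open (𝕜 := 𝕜) hΩc
    isOpen_setOf_reDot_pos hconv hdisj
  have hΩs : ∀ (s : ℝ) (M), 0 < s → M ∈ Ω → s • M ∈ Ω := fun s M hs hM x hx => by
    rw [reDot_mulVec_smul]; exact mul_pos hs (hM x hx)
  have hfs : ∀ (s : ℝ) (M), f (s • M) = (s : 𝕜) * f M := fun s M => by
    rw [← smul_eq_mul, ← map_smul, RCLike.real_smul_eq_coe_smul (K := 𝕜)]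
  have hfr : ∀ (s : ℝ) (M), RCLike.re (f (s • M)) = s * RCLike.re (f M) := fun s M => by
    rw [hfs, RCLike.re_ofReal_mul]
  -- A functional bounded above on a cone is nonpositive there; scaling towards `0` gives `0 ≤ u`
  -- below.
  have hnp : ∀ M ∈ Ω, RCLike.re (f M) ≤ 0 := by
    intro M hM
    by_contra hpos
    push Not at hpos
    have h1 := hfΩ _ (hΩs ((|u| + 1) / RCLike.re (f M)) M (by positivity) hM)
    rw [hfr, div_mul_cancel₀ _ hpos.ne'] at h1
    linarith [le_abs_self u]
  have h1Ω : (1 : Matrix ι ι 𝕜) ∈ Ω := fun x hx => by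
    rw [Matrix.one_mulVec]; exact reDot_self_pos hx
  have hu : 0 ≤ u := by
    by_contra hneg
    push Not at hneg
    have h1 := hnp 1 h1Ω
    have hd : 0 < -RCLike.re (f 1) + 1 := by linarith
    have h2 := hfΩ _ (hΩs (-u / (-RCLike.re (f 1) + 1)) 1 (div_pos (by linarith) hd) h1Ω)
    rw [hfr, div_mul_eq_mul_div, div_lt_iff₀ hd] at h2
    nlinarith
  -- Rank-one matrices lie only in the closure of the cone, hence the perturbation by a small
  -- multiple of `1`.
  have hvv : ∀ x : ι → 𝕜, RCLike.re (f (Matrix.vecMulVec x (star x))) ≤ 0 := by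
    intro x
    refine le_of_forall_pos_le_add fun ε hε => ?_
    have hd : 0 < -RCLike.re (f 1) + 1 := by linarith [hnp 1 h1Ω]
    have hmem : Matrix.vecMulVec x (star x) + (ε / (-RCLike.re (f 1) + 1)) • 1 ∈ Ω := by
      intro y hy
      rw [reDot_mulVec_add, reDot_mulVec_smul, Matrix.one_mulVec]
      have h1 := (Matrix.posSemidef_vecMulVec_self_star x).reDot_nonneg y
      have h2 := mul_pos (div_pos hε hd) (reDot_self_pos hy)
      linarith
    have h3 := hnp _ hmem
    rw [map_add, map_add, hfr, div_mul_eq_mul_div] at h3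
    have h4 : -(ε * RCLike.re (f 1) / (-RCLike.re (f 1) + 1)) ≤ ε := by
      rw [← neg_div, div_le_iff₀ hd]; nlinarith
    linarith
  -- This represents `-f` in the trace pairing. It need not be Hermitian; its Hermitian part gives
  -- the same real traces against Hermitian matrices, up to the factor 2.
  set Z₀ : Matrix ι ι 𝕜 := Matrix.of fun j i => -f (Matrix.single i j 1) with hZ₀
  have htr : ∀ M, (Z₀ * M).trace = -f M := by
    intro M
    conv_rhs => rw [Matrix.matrix_eq_sum_single M]
    simp only [Matrix.trace, Matrix.diag_apply, Matrix.mul_apply, map_sum, hZ₀, Matrix.of_apply]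
    rw [Finset.sum_comm, ← Finset.sum_neg_distrib]
    refine Finset.sum_congr rfl fun i _ => ?_
    rw [← Finset.sum_neg_distrib]
    refine Finset.sum_congr rfl fun j _ => ?_
    have : Matrix.single i j (M i j) = M i j • Matrix.single i j (1 : 𝕜) := by
      rw [Matrix.smul_single, smul_eq_mul, mul_one]
    rw [this, map_smul, smul_eq_mul]
    ring
  have htrH : ∀ M : Matrix ι ι 𝕜, M.IsHermitian →
      RCLike.re ((Z₀ + Z₀ᴴ) * M).trace = -(2 * RCLike.re (f M)) := by
    intro M hM
    rw [Matrix.add_mul, Matrix.trace_add, map_add, re_trace_conjTranspose_mul hM, htr, map_neg]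
    ring
  refine ⟨Z₀ + Z₀ᴴ, ?_, ?_, ?_⟩
  · refine posSemidef_iff_reDot.2 ⟨Matrix.isHermitian_add_transpose_self _, fun x => ?_⟩
    have h1 := htrH _ (Matrix.posSemidef_vecMulVec_self_star x).isHermitian
    rw [Matrix.mul_vecMulVec, Matrix.trace_vecMulVec, dotProduct_comm] at h1
    have := hvv x
    unfold reDot
    linarith
  · intro h0
    obtain ⟨b, hb⟩ := hne
    have h1 := htrH 1 Matrix.isHermitian_one
    have h2 := htrH b (hherm b hb)
    rw [h0] at h1 h2
    simp at h1 h2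
    have h3 := hfΩ 1 h1Ω
    have h4 := hfS b hb
    linarith
  · intro M hM
    rw [htrH M (hherm M hM)]
    linarith [hfS M hM]

end QuadraticForms

/-! ### Elimination of an unstructured matrix variable -/

section Projection

variable {𝕜 : Type*} [RCLike 𝕜] {ι κ μ : Type*} [Fintype ι] [Fintype κ] [Fintype μ]

/-- The orthogonal projection onto the row space of a matrix. -/
theorem Matrix.exists_rowSpace_projection [DecidableEq ι] (G : Matrix κ ι 𝕜) :
    ∃ X : Matrix κ ι 𝕜, G * (Gᴴ * X) = G ∧ (Gᴴ * X)ᴴ = Gᴴ * X ∧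
      (Gᴴ * X) * (Gᴴ * X) = Gᴴ * X := by
  classical
  -- Since `G Gᴴ` and `G` have the same rank, they have the same range, so `G Gᴴ X = G` is solvable.
  -- Then `Π = Gᴴ X` satisfies `Πᴴ Π = Πᴴ`, which forces it to be Hermitian and idempotent.
  have hle : LinearMap.range (G * Gᴴ).mulVecLin ≤ LinearMap.range G.mulVecLin := by
    rw [Matrix.mulVecLin_mul]
    exact LinearMap.range_comp_le_range _ _
  have heq : LinearMap.range (G * Gᴴ).mulVecLin = LinearMap.range G.mulVecLin :=
    Submodule.eq_of_le_of_finrank_eq hle (Matrix.rank_self_mul_conjTranspose G)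
  have hcol : ∀ j, ∃ v, (G * Gᴴ) *ᵥ v = G.col j := by
    intro j
    have : G.col j ∈ LinearMap.range (G * Gᴴ).mulVecLin := by
      rw [heq]
      exact ⟨Pi.single j 1, by simp⟩
    exact this
  choose v hv using hcol
  have h1 : G * (Gᴴ * Matrix.of fun i j => v j i) = G := by
    rw [← Matrix.mul_assoc]
    ext i j
    exact congrFun (hv j) i
  set X : Matrix κ ι 𝕜 := Matrix.of fun i j => v j i
  have h2 : (Gᴴ * X)ᴴ * (Gᴴ * X) = (Gᴴ * X)ᴴ := by
    rw [Matrix.conjTranspose_mul, Matrix.conjTranspose_conjTranspose, Matrix.mul_assoc, h1]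
  have h3 : (Gᴴ * X)ᴴ = Gᴴ * X := by
    have := congrArg Matrix.conjTranspose h2
    rw [Matrix.conjTranspose_mul, Matrix.conjTranspose_conjTranspose] at this
    rw [← h2, this]
  exact ⟨X, h1, h3, by rwa [h3] at h2⟩

theorem Matrix.eq_zero_of_re_trace_conj_nonpos {ρ : Type*} {H : Matrix ι ι 𝕜} {L : Matrix ρ ι 𝕜}
    (hH : ∀ x, x ≠ 0 → L *ᵥ x = 0 → 0 < reDot x (H *ᵥ x)) {F : Matrix ι μ 𝕜} (hF : L * F = 0) :
    0 ≤ RCLike.re (Fᴴ * H * F).trace ∧ (RCLike.re (Fᴴ * H * F).trace ≤ 0 → F = 0) := by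
  have hcol : ∀ j, L *ᵥ F.col j = 0 := fun j => by
    ext i
    exact congrFun (congrFun hF i) j
  have hnn : ∀ j, 0 ≤ reDot (F.col j) (H *ᵥ F.col j) := fun j => by
    by_cases h : F.col j = 0
    · simp [h]
    · exact (hH _ h (hcol j)).le
  rw [re_trace_conj]
  refine ⟨Finset.sum_nonneg fun j _ => hnn j, fun h => ?_⟩
  have h1 := (Finset.sum_eq_zero_iff_of_nonneg (fun j _ => hnn j)).1
    (le_antisymm h (Finset.sum_nonneg fun j _ => hnn j))
  ext i j
  have h2 : F.col j = 0 := by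
    by_contra hne
    exact (hH _ hne (hcol j)).ne' (h1 j (Finset.mem_univ _))
  exact congrFun h2 i

theorem Matrix.eq_zero_of_forall_re_trace_mul [DecidableEq ι] {M : Matrix ι κ 𝕜}
    (h : ∀ N : Matrix κ ι 𝕜, RCLike.re (M * N).trace = 0) : M = 0 := by
  have := h Mᴴ
  rw [← Matrix.trace_mul_conjTranspose_self_eq_zero_iff]
  refine RCLike.ext (by simpa using this) ?_
  rw [map_zero, ← RCLike.conj_eq_iff_im, starRingEnd_apply, ← Matrix.trace_conjTranspose,
    Matrix.conjTranspose_mul, Matrix.conjTranspose_conjTranspose]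

/-- The projection lemma (elimination of an unstructured matrix variable). -/
theorem Matrix.exists_posDef_add_mul_mul {H : Matrix ι ι 𝕜} (hH : H.IsHermitian)
    (U : Matrix ι κ 𝕜) (V : Matrix μ ι 𝕜)
    (hU : ∀ x, x ≠ 0 → Uᴴ *ᵥ x = 0 → 0 < reDot x (H *ᵥ x))
    (hV : ∀ x, x ≠ 0 → V *ᵥ x = 0 → 0 < reDot x (H *ᵥ x)) :
    ∃ K : Matrix κ μ 𝕜, (H + (U * K * V + (U * K * V)ᴴ)).PosDef := by
  classical
  by_contra hno
  push Not at hno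
  set S : Set (Matrix ι ι 𝕜) := Set.range fun K : Matrix κ μ 𝕜 => H + (U * K * V + (U * K * V)ᴴ)
  obtain ⟨Z, hZ, hZ0, hZS⟩ := exists_posSemidef_of_forall_not_posDef (S := S)
    (Set.range_nonempty _) (by
      rintro _ ⟨K, rfl⟩ _ ⟨K', rfl⟩ a b - - hab
      refine ⟨a • K + b • K', ?_⟩
      have hHab : H = a • H + b • H := by rw [← add_smul, hab, one_smul]
      simp only [Matrix.mul_add, Matrix.add_mul, Matrix.mul_smul, Matrix.smul_mul,
        Matrix.conjTranspose_add, Matrix.conjTranspose_smul, star_trivial, smul_add]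
      nth_rewrite 1 [hHab]
      abel)
    (by
      rintro _ ⟨K, rfl⟩
      exact hH.add (Matrix.isHermitian_add_transpose_self _))
    (by rintro _ ⟨K, rfl⟩; exact hno K)
  have hlin : ∀ K : Matrix κ μ 𝕜,
      RCLike.re (Z * H).trace + 2 * RCLike.re (V * Z * U * K).trace ≤ 0 := by
    intro K
    have h1 := hZS _ ⟨K, rfl⟩
    have h2 : RCLike.re (Z * (U * K * V)ᴴ).trace = RCLike.re (Z * (U * K * V)).trace := by
      rw [Matrix.trace_mul_comm, re_trace_conjTranspose_mul hZ.isHermitian, Matrix.trace_mul_comm]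
    have h3 : (Z * (U * K * V)).trace = (V * Z * U * K).trace := by
      rw [← Matrix.mul_assoc, Matrix.trace_mul_comm]
      simp only [Matrix.mul_assoc]
    simp only [Matrix.mul_add, Matrix.trace_add, map_add, h2, h3] at h1
    linarith
  -- An affine function of `K` bounded above has zero linear part; the multiple of `K` used below
  -- makes its value exactly 1.
  have hVZU : V * Z * U = 0 := by
    refine Matrix.eq_zero_of_forall_re_trace_mul fun K => ?_
    by_contra hne
    set τ := RCLike.re (V * Z * U * K).trace
    have h1 := hlin (((1 - RCLike.re (Z * H).trace) / (2 * τ)) • K)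
    rw [Matrix.mul_smul, Matrix.trace_smul, RCLike.smul_re] at h1
    change _ + 2 * (_ / (2 * τ) * τ) ≤ 0 at h1
    have h2 : 2 * ((1 - RCLike.re (Z * H).trace) / (2 * τ) * τ) = 1 - RCLike.re (Z * H).trace := by
      field_simp
    rw [h2] at h1
    linarith
  have hZH : RCLike.re (Z * H).trace ≤ 0 := by simpa using hlin 0
  obtain ⟨B, hB⟩ := hZ.exists_eq_conjTranspose_mul_self
  obtain ⟨X, h1, h2, h3⟩ := Matrix.exists_rowSpace_projection (V * Bᴴ)
  -- Splitting `Z = Bᴴ Q B + Bᴴ (1 - Q) B` along the row space of `V Bᴴ` puts the columns of `Bᴴ Q`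
  -- into `ker Uᴴ`, because `V Z U = 0`, and those of `Bᴴ (1 - Q)` into `ker V`. Positivity of `H`
  -- on both kernels then contradicts `Re tr (Z H) ≤ 0` unless `Z = 0`.
  set Q := (V * Bᴴ)ᴴ * X with hQ
  have hUQ : Uᴴ * (Bᴴ * Q) = 0 := by
    have h4 : (V * Z * U)ᴴ = 0 := by rw [hVZU, Matrix.conjTranspose_zero]
    have h5 : Uᴴ * (Bᴴ * Q) = (V * Z * U)ᴴ * X := by
      rw [hQ, hB]
      simp only [Matrix.conjTranspose_mul, Matrix.conjTranspose_conjTranspose, Matrix.mul_assoc]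
    rw [h5, h4, Matrix.zero_mul]
  have hVQ : V * (Bᴴ * (1 - Q)) = 0 := by
    rw [← Matrix.mul_assoc, Matrix.mul_sub, Matrix.mul_one, h1, sub_self]
  have hsum : RCLike.re (Z * H).trace =
      RCLike.re ((Bᴴ * Q)ᴴ * H * (Bᴴ * Q)).trace +
      RCLike.re ((Bᴴ * (1 - Q))ᴴ * H * (Bᴴ * (1 - Q))).trace := by
    have hq : ∀ R : Matrix ι ι 𝕜, Rᴴ = R → R * R = R →
        ((Bᴴ * R)ᴴ * H * (Bᴴ * R)).trace = (Bᴴ * R * B * H).trace := by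
      intro R hR hRR
      rw [Matrix.conjTranspose_mul, Matrix.conjTranspose_conjTranspose, hR, Matrix.trace_mul_comm]
      congr 1
      calc Bᴴ * R * (R * B * H) = Bᴴ * (R * R) * B * H := by simp only [Matrix.mul_assoc]
        _ = _ := by rw [hRR]
    rw [hq Q h2 h3, hq (1 - Q) (by rw [Matrix.conjTranspose_sub, h2, Matrix.conjTranspose_one])
      (by rw [Matrix.mul_sub, Matrix.sub_mul, Matrix.sub_mul, h3]; simp), ← map_add, ← Matrix.trace_add,
      ← Matrix.add_mul, ← Matrix.add_mul, ← Matrix.mul_add]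
    simp [hB]
  obtain ⟨p1, q1⟩ := Matrix.eq_zero_of_re_trace_conj_nonpos hU hUQ
  obtain ⟨p2, q2⟩ := Matrix.eq_zero_of_re_trace_conj_nonpos hV hVQ
  have e1 := q1 (by linarith)
  have e2 := q2 (by linarith)
  rw [Matrix.mul_sub, e1, Matrix.mul_one, sub_zero] at e2
  exact hZ0 (by rw [hB, e2, Matrix.zero_mul])

end Projection

/-! ### Passage from `𝕜` to the complex numbers -/

section Complexification

variable {𝕜 : Type*} [RCLike 𝕜] {ι κ μ : Type*}

theorem RCLike.map_complex_mul (x y : 𝕜) :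
    RCLike.map 𝕜 ℂ (x * y) = RCLike.map 𝕜 ℂ x * RCLike.map 𝕜 ℂ y := by
  apply Complex.ext <;> simp [RCLike.mul_re, RCLike.mul_im]

theorem RCLike.map_complex_re (x : 𝕜) : (RCLike.map 𝕜 ℂ x).re = RCLike.re x := by
  simp

theorem RCLike.map_complex_one : RCLike.map 𝕜 ℂ 1 = 1 := by
  apply Complex.ext <;> simp

theorem RCLike.map_complex_star (x : 𝕜) : RCLike.map 𝕜 ℂ (star x) = star (RCLike.map 𝕜 ℂ x) := by
  apply Complex.ext <;> simp

theorem RCLike.norm_map_complex (x : 𝕜) : ‖RCLike.map 𝕜 ℂ x‖ = ‖x‖ := by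
  rw [← sq_eq_sq₀ (norm_nonneg _) (norm_nonneg _), RCLike.norm_sq_eq_def, RCLike.norm_sq_eq_def]
  simp

theorem toComplexMatrix_mul [Fintype κ] (M : Matrix ι κ 𝕜) (N : Matrix κ μ 𝕜) :
    toComplexMatrix (M * N) = toComplexMatrix M * toComplexMatrix N := by
  ext i j
  simp only [toComplexMatrix, Matrix.map_apply, Matrix.mul_apply, map_sum, RCLike.map_complex_mul]

theorem toComplexMatrix_add (M N : Matrix ι κ 𝕜) :
    toComplexMatrix (M + N) = toComplexMatrix M + toComplexMatrix N := by
  ext i j; exact map_add (RCLike.map 𝕜 ℂ) _ _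

theorem toComplexMatrix_sub (M N : Matrix ι κ 𝕜) :
    toComplexMatrix (M - N) = toComplexMatrix M - toComplexMatrix N := by
  ext i j; exact map_sub (RCLike.map 𝕜 ℂ) _ _

theorem toComplexMatrix_neg (M : Matrix ι κ 𝕜) :
    toComplexMatrix (-M) = -toComplexMatrix M := by
  ext i j; exact map_neg (RCLike.map 𝕜 ℂ) _

theorem toComplexMatrix_smul (c : ℝ) (M : Matrix ι κ 𝕜) :
    toComplexMatrix (c • M) = c • toComplexMatrix M := by
  ext i j; exact map_smul (RCLike.map 𝕜 ℂ) c (M i j)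

theorem toComplexMatrix_one [DecidableEq ι] :
    toComplexMatrix (1 : Matrix ι ι 𝕜) = 1 :=
  Matrix.map_one _ (map_zero _) RCLike.map_complex_one

theorem toComplexMatrix_conjTranspose (M : Matrix ι κ 𝕜) :
    toComplexMatrix Mᴴ = (toComplexMatrix M)ᴴ := by
  ext i j; exact RCLike.map_complex_star _

theorem toComplexMatrix_pow [Fintype ι] [DecidableEq ι] (M : Matrix ι ι 𝕜) (k : ℕ) :
    toComplexMatrix (M ^ k) = toComplexMatrix M ^ k := by
  induction k with
  | zero => simp [toComplexMatrix_one]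
  | succ k ih => rw [pow_succ, pow_succ, toComplexMatrix_mul, ih]

theorem re_trace_toComplexMatrix [Fintype ι] (M : Matrix ι ι 𝕜) :
    (toComplexMatrix M).trace.re = RCLike.re M.trace := by
  simp only [Matrix.trace, Complex.re_sum, map_sum, Matrix.diag_apply]
  exact Finset.sum_congr rfl fun i _ => RCLike.map_complex_re _

theorem Matrix.PosSemidef.toComplexMatrix [Fintype ι] {M : Matrix ι ι 𝕜} (hM : M.PosSemidef) :
    (toComplexMatrix M).PosSemidef := by
  obtain ⟨B, rfl⟩ := hM.exists_eq_conjTranspose_mul_self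
  rw [toComplexMatrix_mul, toComplexMatrix_conjTranspose]
  exact Matrix.posSemidef_conjTranspose_mul_self _

/-- A Gram factorization and an inverse both survive the entrywise embedding, so complex vectors
need not be split into real and imaginary parts. -/
theorem Matrix.PosDef.toComplexMatrix [Fintype ι] [DecidableEq ι] {M : Matrix ι ι 𝕜}
    (hM : M.PosDef) : (toComplexMatrix M).PosDef := by
  refine hM.posSemidef.toComplexMatrix.posDef_iff_isUnit.2 ?_
  refine (Matrix.isUnit_iff_isUnit_det _).2
    (Matrix.isUnit_det_of_right_inverse (B := _root_.toComplexMatrix M⁻¹) ?_)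
  rw [← toComplexMatrix_mul,
    Matrix.mul_nonsing_inv _ ((Matrix.isUnit_iff_isUnit_det _).1 hM.isUnit), toComplexMatrix_one]

end Complexification

/-! ### Discrete-time Lyapunov theory -/

section Stability

variable {𝕜 : Type*} [RCLike 𝕜] {ι : Type*} [Fintype ι] [DecidableEq ι]

/-- On an eigenvector `v` for `z` the hypothesis reads `(1 - |z|²) vᴴ P v > 0`. -/
theorem spectralRadius_lt_one_of_posDef {A P : Matrix ι ι ℂ} (hP : P.PosDef)
    (hAP : (P - Aᴴ * P * A).PosDef) : spectralRadius ℂ A < 1 := by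
  have hfin : (spectrum ℂ A).Finite := Matrix.finite_spectrum A
  have hlt : ∀ z ∈ spectrum ℂ A, ‖z‖₊ < 1 := by
    intro z hz
    rw [← Matrix.spectrum_toLin', ← Module.End.hasEigenvalue_iff_mem_spectrum] at hz
    obtain ⟨v, hv, hv0⟩ := hz.exists_hasEigenvector
    have hAv : A *ᵥ v = z • v := by
      simpa using Module.End.mem_eigenspace_iff.1 hv
    have h1 := hAP.reDot_pos hv0
    rw [reDot_mulVec_sub, reDot_conj_mulVec, hAv] at h1
    have h2 : reDot (z • v) (P *ᵥ (z • v)) = ‖z‖ ^ 2 * reDot v (P *ᵥ v) := by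
      have : star z * z = ((‖z‖ ^ 2 : ℝ) : ℂ) := by
        rw [← starRingEnd_apply, RCLike.conj_mul]; simp
      unfold reDot
      rw [Matrix.mulVec_smul, star_smul, smul_dotProduct, dotProduct_smul, smul_smul, this,
        smul_eq_mul]
      simp only [RCLike.re_to_complex, Complex.re_ofReal_mul]
    rw [h2] at h1
    have h3 := hP.reDot_pos hv0
    have h4 : ‖z‖ ^ 2 < 1 := by nlinarith
    have h5 : ‖z‖ < 1 := by
      by_contra hge
      push Not at hge
      nlinarith
    exact h5
  unfold spectralRadius
  rcases (spectrum ℂ A).eq_empty_or_nonempty with he | hne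
  · simp [he]
  -- The spectrum is finite, so the supremum is attained and the strict bound survives.
  · obtain ⟨z, hz, hmax⟩ := hfin.exists_maximalFor (fun z => ‖z‖₊) _ hne
    refine lt_of_le_of_lt (b := (‖z‖₊ : ENNReal)) ?_ (by exact_mod_cast hlt z hz)
    refine iSup₂_le fun w hw => ?_
    rcases le_total ‖w‖₊ ‖z‖₊ with h | h
    · exact_mod_cast h
    · exact_mod_cast hmax hw h

theorem isSchurStable_of_posDef {A P : Matrix ι ι 𝕜} (hP : P.PosDef)
    (hAP : (P - Aᴴ * P * A).PosDef) : IsSchurStable A := by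
  refine spectralRadius_lt_one_of_posDef hP.toComplexMatrix ?_
  rw [← toComplexMatrix_conjTranspose, ← toComplexMatrix_mul, ← toComplexMatrix_mul,
    ← toComplexMatrix_sub]
  exact hAP.toComplexMatrix

open Filter Topology

-- Gelfand's formula gives `‖A ^ k‖ ≤ r ^ k` eventually, for some `r` between the spectral radius
-- and 1; the operator norm dominates each entry.
open scoped Matrix.Norms.Operator in
theorem tendsto_pow_apply_of_spectralRadius_lt_one {A : Matrix ι ι ℂ}
    (hA : spectralRadius ℂ A < 1) (i j : ι) :
    Tendsto (fun k : ℕ => ‖(A ^ k) i j‖) atTop (𝓝 0) := by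
  obtain ⟨r, hr, hr1⟩ := ENNReal.lt_iff_exists_nnreal_btwn.1 hA
  have h1 := spectrum.pow_nnnorm_pow_one_div_tendsto_nhds_spectralRadius A
  have h2 := h1.eventually (gt_mem_nhds hr)
  have hr1' : r < 1 := by exact_mod_cast hr1
  refine squeeze_zero' (Eventually.of_forall fun _ => norm_nonneg _) ?_
    (tendsto_pow_atTop_nhds_zero_of_lt_one r.2 hr1')
  filter_upwards [h2, eventually_gt_atTop 0] with k hk hk0
  have hk' : (‖A ^ k‖₊ : ENNReal) < (r : ENNReal) ^ k := by
    rw [one_div] at hk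
    have := (ENNReal.rpow_inv_lt_iff (by exact_mod_cast hk0 : (0 : ℝ) < k)).1 hk
    simpa using this
  have hk'' : ‖A ^ k‖ ≤ (r : ℝ) ^ k := by
    have : ‖A ^ k‖₊ < r ^ k := by exact_mod_cast hk'
    exact_mod_cast this.le
  refine le_trans ?_ hk''
  rw [Matrix.linfty_opNorm_def]
  have h3 : ‖(A ^ k) i j‖₊ ≤ Finset.univ.sup fun i => ∑ j, ‖(A ^ k) i j‖₊ :=
    (Finset.single_le_sum (f := fun j => ‖(A ^ k) i j‖₊) (fun _ _ => zero_le)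
      (Finset.mem_univ j)).trans
      (Finset.le_sup (f := fun i => ∑ j, ‖(A ^ k) i j‖₊) (Finset.mem_univ i))
  exact_mod_cast h3

theorem IsSchurStable.tendsto_pow {A : Matrix ι ι 𝕜} (hA : IsSchurStable A) :
    Tendsto (fun k : ℕ => A ^ k) atTop (𝓝 0) := by
  refine tendsto_pi_nhds.2 fun i => tendsto_pi_nhds.2 fun j => ?_
  rw [Matrix.zero_apply, tendsto_zero_iff_norm_tendsto_zero]
  convert tendsto_pow_apply_of_spectralRadius_lt_one hA i j using 2 with k
  rw [← toComplexMatrix_pow]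
  exact (RCLike.norm_map_complex _).symm

/-- The form of `P` decreases along `A ^ k x`, which tends to zero, so it is nonnegative; the strict
decrease in the first step makes it positive. -/
theorem IsSchurStable.posDef_of_posDef {A P : Matrix ι ι 𝕜} (hA : IsSchurStable A)
    (hP : P.IsHermitian) (hAP : (P - Aᴴ * P * A).PosDef) : P.PosDef := by
  have hle : ∀ x, reDot (A *ᵥ x) (P *ᵥ (A *ᵥ x)) ≤ reDot x (P *ᵥ x) := by
    intro x
    have := hAP.posSemidef.reDot_nonneg x
    rw [reDot_mulVec_sub, reDot_conj_mulVec] at this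
    linarith
  have hpow : ∀ x (k : ℕ), reDot ((A ^ k) *ᵥ x) (P *ᵥ ((A ^ k) *ᵥ x)) ≤ reDot x (P *ᵥ x) := by
    intro x k
    induction k with
    | zero => simp
    | succ k ih =>
      rw [pow_succ', ← Matrix.mulVec_mulVec]
      exact (hle _).trans ih
  have hnn : ∀ x, 0 ≤ reDot x (P *ᵥ x) := by
    intro x
    have hc : Continuous fun M : Matrix ι ι 𝕜 => reDot (M *ᵥ x) (P *ᵥ (M *ᵥ x)) := by
      unfold reDot
      have h1 : Continuous fun M : Matrix ι ι 𝕜 => M *ᵥ x :=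
        continuous_id.matrix_mulVec continuous_const
      exact RCLike.continuous_re.comp (h1.star.dotProduct
        (continuous_const.matrix_mulVec h1))
    have h2 := (hc.tendsto 0).comp hA.tendsto_pow
    simp only [Matrix.zero_mulVec, reDot_zero_left] at h2
    exact le_of_tendsto h2 (Eventually.of_forall fun k => hpow x k)
  refine posDef_iff_reDot.2 ⟨hP, fun x hx => ?_⟩
  have := hAP.reDot_pos hx
  rw [reDot_mulVec_sub, reDot_conj_mulVec] at this
  linarith [hnn (A *ᵥ x)]

/-- Iterating gives `X = A ^ k X (A ^ k)ᴴ`, which tends to zero. -/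
theorem IsSchurStable.eq_zero_of_eq_mul_mul {A X : Matrix ι ι 𝕜} (hA : IsSchurStable A)
    (hX : X = A * X * Aᴴ) : X = 0 := by
  have hpow : ∀ k : ℕ, X = A ^ k * X * (A ^ k)ᴴ := by
    intro k
    induction k with
    | zero => simp
    | succ k ih =>
      nth_rewrite 1 [ih]
      nth_rewrite 1 [hX]
      rw [pow_succ, Matrix.conjTranspose_mul]
      simp only [Matrix.mul_assoc]
  have hc : Continuous fun M : Matrix ι ι 𝕜 => M * X * Mᴴ :=
    (continuous_id.matrix_mul continuous_const).matrix_mul continuous_id.matrix_conjTranspose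
  have h2 := (hc.tendsto 0).comp hA.tendsto_pow
  simp only [Matrix.zero_mul] at h2
  refine tendsto_nhds_unique ?_ h2
  exact tendsto_const_nhds.congr hpow

end Stability

/-! ### Duality for the relaxed `k`-sparse norm -/

section Duality

variable {𝕜 : Type*} [RCLike 𝕜] {n m p : Type*} [Fintype n] [Fintype m] [Fintype p]

theorem trace_fromBlocks_mul_fromBlocks_diag {a b : Type*} [Fintype a] [Fintype b]
    (X : Matrix a a 𝕜) (R : Matrix a b 𝕜) (T : Matrix b a 𝕜) (W : Matrix b b 𝕜)
    (M : Matrix a a 𝕜) (N : Matrix b b 𝕜) :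
    (Matrix.fromBlocks X R T W * Matrix.fromBlocks M 0 0 N).trace =
      (X * M).trace + (W * N).trace := by
  rw [Matrix.fromBlocks_multiply]
  simp [Matrix.trace, Fintype.sum_sum_type]

theorem re_trace_mul_le {W Y : Matrix m m 𝕜} {t : ℝ} (hY : ∀ i j, ‖Y i j‖ ≤ t) :
    RCLike.re (W * Y).trace ≤ t * ∑ i, ∑ j, ‖W i j‖ := by
  simp only [Matrix.trace, Matrix.diag_apply, Matrix.mul_apply, map_sum, Finset.mul_sum]
  refine Finset.sum_le_sum fun i _ => Finset.sum_le_sum fun j _ => ?_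
  refine (RCLike.re_le_norm _).trans ?_
  rw [norm_mul, mul_comm]
  exact mul_le_mul_of_nonneg_right (hY j i) (norm_nonneg _)

theorem zero_mem_relaxationValues (S : StateSpace 𝕜 n m p) (k : ℕ) :
    0 ∈ relaxationValues S k := by
  refine ⟨0, 0, 0, ⟨?_, ?_, ?_, ?_⟩, ?_⟩ <;>
    simp [relaxationObjective, Matrix.PosSemidef.zero]

/-- This lets the multiplier found over `𝕜` in strong duality compete in the complex relaxation. -/
theorem mem_relaxationValues {S : StateSpace 𝕜 n m p} {k : ℕ} {X : Matrix n n 𝕜}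
    {R : Matrix n m 𝕜} {W : Matrix m m 𝕜}
    (hX : X = Matrix.fromCols S.A S.B * Matrix.fromBlocks X R Rᴴ W *
      Matrix.fromRows S.Aᴴ S.Bᴴ)
    (htr : RCLike.re W.trace ≤ 1) (hsum : ∑ i, ∑ j, ‖W i j‖ ≤ (k : ℝ))
    (hpos : (Matrix.fromBlocks X R Rᴴ W).PosSemidef) :
    RCLike.re (Matrix.fromBlocks (S.Cᴴ * S.C) (S.Cᴴ * S.D) (S.Dᴴ * S.C) (S.Dᴴ * S.D) *
      Matrix.fromBlocks X R Rᴴ W).trace ∈ relaxationValues S k := by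
  have hfb : ∀ (a : Matrix n n 𝕜) (b : Matrix n m 𝕜) (c : Matrix m n 𝕜) (d : Matrix m m 𝕜),
      toComplexMatrix (Matrix.fromBlocks a b c d) = Matrix.fromBlocks (toComplexMatrix a)
        (toComplexMatrix b) (toComplexMatrix c) (toComplexMatrix d) := fun a b c d =>
    Matrix.fromBlocks_map _ _ _ _ _
  have hfc : ∀ (a : Matrix n n 𝕜) (b : Matrix n m 𝕜),
      toComplexMatrix (Matrix.fromCols a b) =
        Matrix.fromCols (toComplexMatrix a) (toComplexMatrix b) := fun a b => by
    ext i (j | j) <;> rfl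
  have hfr : ∀ (a : Matrix n n 𝕜) (b : Matrix m n 𝕜),
      toComplexMatrix (Matrix.fromRows a b) =
        Matrix.fromRows (toComplexMatrix a) (toComplexMatrix b) := fun a b => by
    ext (i | i) j <;> rfl
  refine ⟨toComplexMatrix X, toComplexMatrix R, toComplexMatrix W, ⟨?_, ?_, ?_, ?_⟩, ?_⟩
  · have h := congrArg toComplexMatrix hX
    simpa only [toComplexMatrix_mul, hfb, hfc, hfr, toComplexMatrix_conjTranspose,
      StateSpace.toComplex] using h
  · rwa [re_trace_toComplexMatrix]
  · simpa only [toComplexMatrix, Matrix.map_apply, RCLike.norm_map_complex] using hsum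
  · have h := hpos.toComplexMatrix
    rwa [hfb, toComplexMatrix_conjTranspose] at h
  · rw [relaxationObjective, ← re_trace_toComplexMatrix]
    simp only [toComplexMatrix_mul, hfb, toComplexMatrix_conjTranspose, StateSpace.toComplex]

variable [DecidableEq m]

/-- The negated matrix of the dissipation inequality with storage function `xᴴ P x`. -/
def dissipation (S : StateSpace 𝕜 n m p) (P : Matrix n n 𝕜) (Y : Matrix m m 𝕜) (lam : ℝ) :
    Matrix (n ⊕ m) (n ⊕ m) 𝕜 :=
  -(Matrix.fromBlocks
      (S.Aᴴ * P * S.A - P) (S.Aᴴ * P * S.B)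
      (S.Bᴴ * P * S.A) (S.Bᴴ * P * S.B - lam • (1 : Matrix m m 𝕜) - Y) +
    Matrix.fromBlocks
      (S.Cᴴ * S.C) (S.Cᴴ * S.D)
      (S.Dᴴ * S.C) (S.Dᴴ * S.D))

theorem dissipation_eq {m : Type*} [DecidableEq m] (S : StateSpace 𝕜 n m p) (P : Matrix n n 𝕜) (Y : Matrix m m 𝕜) (lam : ℝ) :
    dissipation S P Y lam = Matrix.fromBlocks P 0 0 (lam • (1 : Matrix m m 𝕜) + Y) -
      (Matrix.fromCols S.A S.B)ᴴ * P * Matrix.fromCols S.A S.B -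
      (Matrix.fromCols S.C S.D)ᴴ * Matrix.fromCols S.C S.D := by
  rw [Matrix.conjTranspose_fromCols_eq_fromRows_conjTranspose,
    Matrix.conjTranspose_fromCols_eq_fromRows_conjTranspose, Matrix.fromRows_mul,
    Matrix.fromRows_mul_fromCols, Matrix.fromRows_mul_fromCols, dissipation]
  ext (i | i) (j | j) <;> simp <;> ring

theorem dissipation_convex_combination (S : StateSpace 𝕜 n m p) (P P' : Matrix n n 𝕜)
    (Y Y' : Matrix m m 𝕜) (lam lam' : ℝ) {a b : ℝ} (hab : a + b = 1) :
    dissipation S (a • P + b • P') (a • Y + b • Y') (a * lam + b * lam') =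
      a • dissipation S P Y lam + b • dissipation S P' Y' lam' := by
  have hF : (Matrix.fromCols S.C S.D)ᴴ * Matrix.fromCols S.C S.D =
      a • ((Matrix.fromCols S.C S.D)ᴴ * Matrix.fromCols S.C S.D) +
      b • ((Matrix.fromCols S.C S.D)ᴴ * Matrix.fromCols S.C S.D) := by
    rw [← add_smul, hab, one_smul]
  have hB : Matrix.fromBlocks (a • P + b • P') 0 0
      ((a * lam + b * lam') • (1 : Matrix m m 𝕜) + (a • Y + b • Y')) =
      a • Matrix.fromBlocks P 0 0 (lam • (1 : Matrix m m 𝕜) + Y) +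
      b • Matrix.fromBlocks P' 0 0 (lam' • (1 : Matrix m m 𝕜) + Y') := by
    rw [Matrix.fromBlocks_smul, Matrix.fromBlocks_smul, Matrix.fromBlocks_add]
    simp only [smul_zero, add_zero, smul_add, add_smul, mul_smul]
    congr 1
    abel
  rw [dissipation_eq, dissipation_eq, dissipation_eq, hB]
  nth_rewrite 1 [hF]
  simp only [Matrix.mul_add, Matrix.add_mul, Matrix.mul_smul, Matrix.smul_mul, smul_sub]
  abel

theorem isHermitian_dissipation (S : StateSpace 𝕜 n m p) {P : Matrix n n 𝕜} {Y : Matrix m m 𝕜}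
    (hP : P.IsHermitian) (hY : Y.IsHermitian) (lam : ℝ) :
    (dissipation S P Y lam).IsHermitian := by
  rw [dissipation_eq]
  refine ((Matrix.IsHermitian.fromBlocks hP (by simp) ?_).sub
    (Matrix.isHermitian_conjTranspose_mul_mul _ hP)).sub
    (Matrix.isHermitian_conjTranspose_mul_self _)
  refine Matrix.IsHermitian.add ?_ hY
  rw [Matrix.IsHermitian, Matrix.conjTranspose_smul, Matrix.conjTranspose_one, star_trivial]

/-- The Lagrangian identity between the relaxation and the dissipation inequality. -/
theorem re_trace_mul_dissipation (S : StateSpace 𝕜 n m p) (P : Matrix n n 𝕜) (Y : Matrix m m 𝕜)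
    (lam : ℝ) (X : Matrix n n 𝕜) (R : Matrix n m 𝕜) (W : Matrix m m 𝕜) :
    RCLike.re (Matrix.fromBlocks X R Rᴴ W * dissipation S P Y lam).trace =
      RCLike.re ((X - Matrix.fromCols S.A S.B * Matrix.fromBlocks X R Rᴴ W *
        Matrix.fromRows S.Aᴴ S.Bᴴ) * P).trace + lam * RCLike.re W.trace +
      RCLike.re (W * Y).trace -
      RCLike.re (Matrix.fromBlocks (S.Cᴴ * S.C) (S.Cᴴ * S.D) (S.Dᴴ * S.C) (S.Dᴴ * S.D) *
        Matrix.fromBlocks X R Rᴴ W).trace := by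
  have h1 : Matrix.fromBlocks (S.Cᴴ * S.C) (S.Cᴴ * S.D) (S.Dᴴ * S.C) (S.Dᴴ * S.D) =
      (Matrix.fromCols S.C S.D)ᴴ * Matrix.fromCols S.C S.D := by
    rw [Matrix.conjTranspose_fromCols_eq_fromRows_conjTranspose, Matrix.fromRows_mul_fromCols]
  have h2 : ∀ V : Matrix (n ⊕ m) (n ⊕ m) 𝕜,
      (V * ((Matrix.fromCols S.A S.B)ᴴ * P * Matrix.fromCols S.A S.B)).trace =
      (Matrix.fromCols S.A S.B * V * Matrix.fromRows S.Aᴴ S.Bᴴ * P).trace := by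
    intro V
    rw [← Matrix.conjTranspose_fromCols_eq_fromRows_conjTranspose, ← Matrix.mul_assoc,
      Matrix.trace_mul_comm]
    simp only [Matrix.mul_assoc]
  rw [h1, dissipation_eq, Matrix.mul_sub, Matrix.mul_sub, Matrix.trace_sub, Matrix.trace_sub,
    trace_fromBlocks_mul_fromBlocks_diag, h2, Matrix.trace_mul_comm (Matrix.fromBlocks X R Rᴴ W),
    Matrix.sub_mul, Matrix.trace_sub, Matrix.mul_add, Matrix.mul_smul, Matrix.mul_one,
    Matrix.trace_add, Matrix.trace_smul]
  simp only [map_sub, map_add, RCLike.smul_re]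
  ring

theorem toComplexMatrix_dissipation {m : Type*} [DecidableEq m] (S : StateSpace 𝕜 n m p) (P : Matrix n n 𝕜)
    (Y : Matrix m m 𝕜) (lam : ℝ) :
    toComplexMatrix (dissipation S P Y lam) =
      dissipation S.toComplex (toComplexMatrix P) (toComplexMatrix Y) lam := by
  have hfb : ∀ (a : Matrix n n 𝕜) (b : Matrix n m 𝕜) (c : Matrix m n 𝕜) (d : Matrix m m 𝕜),
      toComplexMatrix (Matrix.fromBlocks a b c d) = Matrix.fromBlocks (toComplexMatrix a)
        (toComplexMatrix b) (toComplexMatrix c) (toComplexMatrix d) := fun a b c d =>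
    Matrix.fromBlocks_map _ _ _ _ _
  simp only [dissipation, StateSpace.toComplex, toComplexMatrix_neg, toComplexMatrix_add, hfb,
    toComplexMatrix_sub, toComplexMatrix_mul, toComplexMatrix_conjTranspose, toComplexMatrix_smul,
    toComplexMatrix_one]

/-- Weak duality. -/
theorem relaxationValues_le {S : StateSpace 𝕜 n m p} {k : ℕ} {P : Matrix n n 𝕜}
    {Y : Matrix m m 𝕜} {lam t : ℝ} (hY : SparsityConstraints Y lam t) [DecidableEq n]
    (hS : (dissipation S P Y lam).PosDef) {v : ℝ} (hv : v ∈ relaxationValues S k) :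
    v ≤ lam + k * t := by
  obtain ⟨X, R, W, hV, rfl⟩ := hv
  have h1 := hV.posSemidef.re_trace_mul_nonneg hS.toComplexMatrix.posSemidef
  rw [toComplexMatrix_dissipation, re_trace_mul_dissipation, ← hV.stationary, sub_self,
    Matrix.zero_mul, Matrix.trace_zero, map_zero, zero_add] at h1
  have h2 : RCLike.re (W * toComplexMatrix Y).trace ≤ t * ∑ i, ∑ j, ‖W i j‖ :=
    re_trace_mul_le fun i j => by
      change ‖RCLike.map 𝕜 ℂ (Y i j)‖ ≤ t
      rw [RCLike.norm_map_complex]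
      exact hY.abs_le i j
  have h3 := mul_le_mul_of_nonneg_left hV.sum_norm_le hY.t_nonneg
  have h4 := mul_le_mul_of_nonneg_left hV.trace_le hY.lam_nonneg
  simp only [RCLike.re_to_complex] at h1 h2
  unfold relaxationObjective
  linarith

end Duality

/-! ### Strong duality by separation -/

section StrongDuality

theorem nonpos_of_forall_mul_add_nonpos {a b : ℝ} (h : ∀ s : ℝ, 0 ≤ s → s * a + b ≤ 0) :
    a ≤ 0 := by
  by_contra ha
  push Not at ha
  have h1 := h ((|b| + 1) / a) (by positivity)
  rw [div_mul_cancel₀ _ ha.ne'] at h1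
  linarith [neg_abs_le b]

variable {𝕜 : Type*} [RCLike 𝕜]

theorem Matrix.IsHermitian.eq_zero_of_forall_re_trace_mul {ι : Type*} [Fintype ι]
    {N : Matrix ι ι 𝕜} (hN : N.IsHermitian) {c : ℝ}
    (h : ∀ P : Matrix ι ι 𝕜, P.IsHermitian → RCLike.re (N * P).trace + c ≤ 0) : N = 0 := by
  have h1 : RCLike.re (N * N).trace ≤ 0 := nonpos_of_forall_mul_add_nonpos (b := c) fun s _ => by
    have h2 := h (s • N) (by
      rw [Matrix.IsHermitian, Matrix.conjTranspose_smul, hN.eq, star_trivial])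
    rwa [Matrix.mul_smul, Matrix.trace_smul, RCLike.smul_re] at h2
  classical
  have h2 : (Nᴴ * N).PosSemidef := Matrix.posSemidef_conjTranspose_mul_self N
  have h3 := h2.eq_zero_of_re_trace_mul_nonpos Matrix.PosDef.one
    (by rwa [Matrix.mul_one, hN.eq])
  exact Matrix.conjTranspose_mul_self_eq_zero.1 h3

variable {n m p : Type*} [Fintype n] [Fintype m] [Fintype p]

/-- This rules out degenerate multipliers. A positive semidefinite `W` of nonpositive trace
vanishes, a Gram factorization then kills `R`, and stationarity becomes `X = A X Aᴴ`. -/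
theorem Matrix.fromBlocks_eq_zero_of_stationary [DecidableEq n] {A : Matrix n n 𝕜}
    {B : Matrix n m 𝕜} (hA : IsSchurStable A) {X : Matrix n n 𝕜} {R : Matrix n m 𝕜}
    {W : Matrix m m 𝕜} (hV : (Matrix.fromBlocks X R Rᴴ W).PosSemidef)
    (hX : X = Matrix.fromCols A B * Matrix.fromBlocks X R Rᴴ W * Matrix.fromRows Aᴴ Bᴴ)
    (hW : RCLike.re W.trace ≤ 0) : Matrix.fromBlocks X R Rᴴ W = 0 := by
  classical
  have hWp : W.PosSemidef := hV.submatrix Sum.inr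
  have hW0 : W = 0 := hWp.eq_zero_of_re_trace_mul_nonpos Matrix.PosDef.one
    (by rwa [Matrix.mul_one])
  obtain ⟨L, hL⟩ := hV.exists_eq_conjTranspose_mul_self
  rw [← Matrix.fromCols_toCols L, Matrix.conjTranspose_fromCols_eq_fromRows_conjTranspose,
    Matrix.fromRows_mul_fromCols, Matrix.fromBlocks_inj] at hL
  obtain ⟨-, hR, -, hWL⟩ := hL
  have hR0 : R = 0 := by
    rw [hR, Matrix.conjTranspose_mul_self_eq_zero.1 (hWL.symm.trans hW0), Matrix.mul_zero]
  subst hW0 hR0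
  have hX0 : X = 0 := hA.eq_zero_of_eq_mul_mul (by
    rw [Matrix.fromCols_mul_fromBlocks, Matrix.fromCols_mul_fromRows] at hX
    simpa using hX)
  rw [hX0, Matrix.conjTranspose_zero, Matrix.fromBlocks_zero]

variable [DecidableEq m]

/-- The matrix attaining the dual norm in the entrywise duality between `ℓ¹` and `ℓ^∞`. -/
def phaseMatrix (W : Matrix m m 𝕜) : Matrix m m 𝕜 :=
  Matrix.of fun i j => ((‖W i j‖⁻¹ : ℝ) : 𝕜) * W i j

theorem re_trace_mul_phaseMatrix {W : Matrix m m 𝕜} (hW : W.IsHermitian) :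
    RCLike.re (W * phaseMatrix W).trace = ∑ i, ∑ j, ‖W i j‖ := by
  simp only [Matrix.trace, Matrix.diag_apply, Matrix.mul_apply, map_sum]
  refine Finset.sum_congr rfl fun i _ => Finset.sum_congr rfl fun j _ => ?_
  rw [phaseMatrix, Matrix.of_apply, ← hW.apply j i, norm_star, mul_left_comm, ← starRingEnd_apply,
    RCLike.mul_conj, ← RCLike.ofReal_pow, ← RCLike.ofReal_mul, RCLike.ofReal_re, sq, ← mul_assoc]
  -- Zero entries have phase zero, by the convention `0⁻¹ = 0`.
  by_cases h : ‖W i j‖ = 0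
  · simp [h]
  · rw [inv_mul_cancel₀ h, one_mul]

theorem sparsityConstraints_phaseMatrix {W : Matrix m m 𝕜} (hW : W.IsHermitian) {s : ℝ}
    (hs : 0 ≤ s) : SparsityConstraints (s • phaseMatrix W) 0 s := by
  refine ⟨fun i j => ?_, ?_, hs, le_rfl⟩
  · rw [Matrix.smul_apply, norm_smul, Real.norm_of_nonneg hs, phaseMatrix, Matrix.of_apply,
      norm_mul, RCLike.norm_ofReal, abs_inv, abs_norm]
    refine mul_le_of_le_one_right hs ?_
    exact inv_mul_le_one
  · rw [Matrix.IsHermitian, Matrix.conjTranspose_smul, star_trivial]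
    congr 1
    ext i j
    simp only [phaseMatrix, Matrix.conjTranspose_apply, Matrix.of_apply, star_mul',
      hW.apply i j]
    rw [← starRingEnd_apply, RCLike.conj_ofReal, ← hW.apply i j, norm_star]

theorem SparsityConstraints.convex_combination {Y Y' : Matrix m m 𝕜} {lam lam' t t' : ℝ}
    (h : SparsityConstraints Y lam t) (h' : SparsityConstraints Y' lam' t') {a b : ℝ}
    (ha : 0 ≤ a) (hb : 0 ≤ b) :
    SparsityConstraints (a • Y + b • Y') (a * lam + b * lam') (a * t + b * t') := by
  refine ⟨fun i j => ?_, ?_, ?_, ?_⟩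
  · refine (norm_add_le _ _).trans ?_
    rw [Matrix.smul_apply, Matrix.smul_apply, norm_smul, norm_smul, Real.norm_of_nonneg ha,
      Real.norm_of_nonneg hb]
    exact add_le_add (mul_le_mul_of_nonneg_left (h.abs_le i j) ha)
      (mul_le_mul_of_nonneg_left (h'.abs_le i j) hb)
  · rw [Matrix.IsHermitian, Matrix.conjTranspose_add, Matrix.conjTranspose_smul,
      Matrix.conjTranspose_smul, h.isHermitian.eq, h'.isHermitian.eq, star_trivial, star_trivial]
  · exact add_nonneg (mul_nonneg ha h.t_nonneg) (mul_nonneg hb h'.t_nonneg)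
  · exact add_nonneg (mul_nonneg ha h.lam_nonneg) (mul_nonneg hb h'.lam_nonneg)

theorem sparsityConstraints_zero {lam : ℝ} (h : 0 ≤ lam) :
    SparsityConstraints (0 : Matrix m m 𝕜) lam 0 :=
  ⟨fun i j => by simp, Matrix.isHermitian_zero, le_rfl, h⟩

theorem isHermitian_sub_stationary {A : Matrix n n 𝕜} {B : Matrix n m 𝕜}
    {V : Matrix (n ⊕ m) (n ⊕ m) 𝕜} (hV : V.IsHermitian) {X : Matrix n n 𝕜}
    (hX : X.IsHermitian) :
    (X - Matrix.fromCols A B * V * Matrix.fromRows Aᴴ Bᴴ).IsHermitian := by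
  refine hX.sub ?_
  have := Matrix.isHermitian_conjTranspose_mul_mul (Matrix.fromCols A B)ᴴ hV
  rwa [Matrix.conjTranspose_conjTranspose,
    Matrix.conjTranspose_fromCols_eq_fromRows_conjTranspose] at this

variable [DecidableEq n]

theorem Matrix.PosSemidef.exists_fromBlocks {a b : Type*} {V : Matrix (a ⊕ b) (a ⊕ b) 𝕜}
    (hV : V.PosSemidef) :
    ∃ (X : Matrix a a 𝕜) (R : Matrix a b 𝕜) (W : Matrix b b 𝕜),
      V = Matrix.fromBlocks X R Rᴴ W ∧ X.PosSemidef ∧ W.PosSemidef := by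
  refine ⟨V.toBlocks₁₁, V.toBlocks₁₂, V.toBlocks₂₂, ?_, hV.submatrix Sum.inl,
    hV.submatrix Sum.inr⟩
  have h : V.toBlocks₁₂ᴴ = V.toBlocks₂₁ := by
    ext i j
    exact hV.isHermitian.apply _ _
  rw [h, Matrix.fromBlocks_toBlocks]

/-- A stable system satisfies a strict dissipation inequality. -/
theorem IsSchurStable.exists_posDef_dissipation {S : StateSpace 𝕜 n m p}
    (hA : IsSchurStable S.A) :
    ∃ (P : Matrix n n 𝕜) (lam : ℝ), P.IsHermitian ∧ 0 ≤ lam ∧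
      (dissipation S P 0 lam).PosDef := by
  by_contra hno
  push Not at hno
  set T : Set (Matrix (n ⊕ m) (n ⊕ m) 𝕜) :=
    {M | ∃ (P : Matrix n n 𝕜) (lam : ℝ), P.IsHermitian ∧ 0 ≤ lam ∧ M = dissipation S P 0 lam}
  obtain ⟨V, hV, hV0, hVT⟩ := exists_posSemidef_of_forall_not_posDef (S := T)
    ⟨_, 0, 0, Matrix.isHermitian_zero, le_rfl, rfl⟩ (by
      rintro _ ⟨P, lam, hP, hl, rfl⟩ _ ⟨P', lam', hP', hl', rfl⟩ a b ha hb hab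
      refine ⟨a • P + b • P', a * lam + b * lam', ?_, by positivity, ?_⟩
      · rw [Matrix.IsHermitian, Matrix.conjTranspose_add, Matrix.conjTranspose_smul,
          Matrix.conjTranspose_smul, hP.eq, hP'.eq, star_trivial, star_trivial]
      · have := dissipation_convex_combination S P P' 0 0 lam lam' hab
        rw [← this, smul_zero, smul_zero, add_zero])
    (by
      rintro _ ⟨P, lam, hP, -, rfl⟩
      exact isHermitian_dissipation S hP Matrix.isHermitian_zero lam)
    (by rintro _ ⟨P, lam, hP, hl, rfl⟩; exact hno P lam hP hl)
  obtain ⟨X, R, W, rfl, hX, hW⟩ := hV.exists_fromBlocks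
  refine hV0 (Matrix.fromBlocks_eq_zero_of_stationary hA hV (B := S.B) ?_ ?_)
  · refine sub_eq_zero.1 ((isHermitian_sub_stationary hV.isHermitian
      hX.isHermitian).eq_zero_of_forall_re_trace_mul (c := -RCLike.re (Matrix.fromBlocks
        (S.Cᴴ * S.C) (S.Cᴴ * S.D) (S.Dᴴ * S.C) (S.Dᴴ * S.D) *
        Matrix.fromBlocks X R Rᴴ W).trace) fun P hP => ?_)
    have h := hVT _ ⟨P, 0, hP, le_rfl, rfl⟩
    rw [re_trace_mul_dissipation] at h
    simpa [sub_eq_add_neg] using h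
  · refine nonpos_of_forall_mul_add_nonpos (b := -RCLike.re (Matrix.fromBlocks (S.Cᴴ * S.C)
      (S.Cᴴ * S.D) (S.Dᴴ * S.C) (S.Dᴴ * S.D) * Matrix.fromBlocks X R Rᴴ W).trace) fun s hs => ?_
    have h := hVT _ ⟨0, s, Matrix.isHermitian_zero, hs, rfl⟩
    rw [re_trace_mul_dissipation] at h
    simpa [sub_eq_add_neg] using h

/-- Strong duality. -/
theorem IsSchurStable.exists_posDef_dissipation_of_lt {S : StateSpace 𝕜 n m p}
    (hA : IsSchurStable S.A) {k : ℕ} {β : ℝ} (hβ : ∀ v ∈ relaxationValues S k, v < β) :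
    ∃ (P : Matrix n n 𝕜) (Y : Matrix m m 𝕜) (lam t : ℝ), P.IsHermitian ∧
      SparsityConstraints Y lam t ∧ (dissipation S P Y lam).PosDef ∧ lam + k * t < β := by
  by_contra hno
  push Not at hno
  set cst : ℝ → Matrix Unit Unit 𝕜 := fun s => s • 1 with hcst
  -- The extra scalar block encodes the cost bound `λ + k t < β` as one more positivity condition;
  -- its multiplier `c` becomes the normalization of `V`.
  set T : Set (Matrix ((n ⊕ m) ⊕ Unit) ((n ⊕ m) ⊕ Unit) 𝕜) :=
    {M | ∃ (P : Matrix n n 𝕜) (Y : Matrix m m 𝕜) (lam t : ℝ), P.IsHermitian ∧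
      SparsityConstraints Y lam t ∧
      M = Matrix.fromBlocks (dissipation S P Y lam) 0 0 (cst (β - (lam + k * t)))}
  have hcherm : ∀ s, (cst s).IsHermitian := fun s => by
    rw [Matrix.IsHermitian, hcst, Matrix.conjTranspose_smul, star_trivial,
      Matrix.conjTranspose_one]
  obtain ⟨Z, hZ, hZ0, hZT⟩ := exists_posSemidef_of_forall_not_posDef (S := T)
    ⟨_, 0, 0, 0, 0, Matrix.isHermitian_zero, sparsityConstraints_zero le_rfl, rfl⟩ (by
      rintro _ ⟨P, Y, lam, t, hP, hY, rfl⟩ _ ⟨P', Y', lam', t', hP', hY', rfl⟩ a b ha hb hab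
      refine ⟨a • P + b • P', a • Y + b • Y', a * lam + b * lam', a * t + b * t', ?_,
        hY.convex_combination hY' ha hb, ?_⟩
      · rw [Matrix.IsHermitian, Matrix.conjTranspose_add, Matrix.conjTranspose_smul,
          Matrix.conjTranspose_smul, hP.eq, hP'.eq, star_trivial, star_trivial]
      · rw [dissipation_convex_combination S P P' Y Y' lam lam' hab, Matrix.fromBlocks_smul,
          Matrix.fromBlocks_smul, Matrix.fromBlocks_add]
        simp only [smul_zero, add_zero, hcst, smul_smul, ← add_smul]
        congr 2
        rw [← eq_sub_iff_add_eq] at hab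
        rw [hab]
        ring)
    (by
      rintro _ ⟨P, Y, lam, t, hP, hY, rfl⟩
      exact Matrix.IsHermitian.fromBlocks (isHermitian_dissipation S hP hY.isHermitian lam)
        (by simp) (hcherm _))
    (by
      rintro _ ⟨P, Y, lam, t, hP, hY, rfl⟩ hpos
      have h1 : (dissipation S P Y lam).PosDef := hpos.submatrix Sum.inl_injective
      have h2 : (cst (β - (lam + k * t))).PosDef := hpos.submatrix Sum.inr_injective
      have h3 := hno P Y lam t hP hY h1
      have h4 := h2.reDot_pos (x := fun _ => 1) (Function.ne_iff.2 ⟨(), one_ne_zero⟩)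
      rw [hcst, reDot_mulVec_smul, Matrix.one_mulVec, reDot_self] at h4
      simp at h4
      linarith)
  obtain ⟨V, F, z, rfl, hV, hz⟩ := hZ.exists_fromBlocks
  obtain ⟨X, R, W, rfl, hX, hW⟩ := hV.exists_fromBlocks
  set c : ℝ := RCLike.re z.trace with hc
  have hc0 : 0 ≤ c := (RCLike.nonneg_iff.1 hz.trace_nonneg).1
  set obj := RCLike.re (Matrix.fromBlocks (S.Cᴴ * S.C) (S.Cᴴ * S.D) (S.Dᴴ * S.C) (S.Dᴴ * S.D) *
    Matrix.fromBlocks X R Rᴴ W).trace with hobj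
  have hmain : ∀ (P : Matrix n n 𝕜) (Y : Matrix m m 𝕜) (lam t : ℝ), P.IsHermitian →
      SparsityConstraints Y lam t →
      RCLike.re ((X - Matrix.fromCols S.A S.B * Matrix.fromBlocks X R Rᴴ W *
        Matrix.fromRows S.Aᴴ S.Bᴴ) * P).trace + lam * RCLike.re W.trace +
        RCLike.re (W * Y).trace - obj + (β - (lam + k * t)) * c ≤ 0 := by
    intro P Y lam t hP hY
    have h := hZT _ ⟨P, Y, lam, t, hP, hY, rfl⟩
    rw [trace_fromBlocks_mul_fromBlocks_diag, map_add, re_trace_mul_dissipation, hcst,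
      Matrix.mul_smul, Matrix.mul_one, Matrix.trace_smul, RCLike.smul_re] at h
    exact h
  -- Each constraint of the relaxation, homogenized by `c`, comes from sending one variable to
  -- infinity: `P` gives stationarity, `λ` the trace bound, and `Y` along the phases of `W` with `t`
  -- the entrywise bound.
  have hstat : X = Matrix.fromCols S.A S.B * Matrix.fromBlocks X R Rᴴ W *
        Matrix.fromRows S.Aᴴ S.Bᴴ := by
    refine sub_eq_zero.1 ((isHermitian_sub_stationary hV.isHermitian
      hX.isHermitian).eq_zero_of_forall_re_trace_mul (c := -obj + β * c) fun P hP => ?_)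
    have h := hmain P 0 0 0 hP (sparsityConstraints_zero le_rfl)
    simp only [Matrix.mul_zero, Matrix.trace_zero, map_zero] at h
    linarith
  have htr : RCLike.re W.trace ≤ c := by
    refine sub_nonpos.1 (nonpos_of_forall_mul_add_nonpos (b := -obj + β * c) fun s hs => ?_)
    have h := hmain 0 0 s 0 Matrix.isHermitian_zero (sparsityConstraints_zero hs)
    simp only [Matrix.mul_zero, Matrix.trace_zero, map_zero] at h
    linarith
  have hsum : ∑ i, ∑ j, ‖W i j‖ ≤ c * k := by
    refine sub_nonpos.1 (nonpos_of_forall_mul_add_nonpos (b := -obj + β * c) fun s hs => ?_)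
    have h := hmain 0 (s • phaseMatrix W) 0 s Matrix.isHermitian_zero
      (sparsityConstraints_phaseMatrix hW.isHermitian hs)
    rw [Matrix.mul_smul, Matrix.trace_smul, RCLike.smul_re,
      re_trace_mul_phaseMatrix hW.isHermitian] at h
    simp only [Matrix.mul_zero, Matrix.trace_zero, map_zero] at h
    linarith
  have hval : β * c ≤ obj := by
    have h := hmain 0 0 0 0 Matrix.isHermitian_zero (sparsityConstraints_zero le_rfl)
    simp only [Matrix.mul_zero, Matrix.trace_zero, map_zero] at h
    linarith
  -- For `c = 0` stability forces `V = 0`, so `Z` has trace zero and vanishes. For `c > 0` the point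
  -- `c⁻¹ V` is feasible with value at least `β`.
  rcases hc0.eq_or_lt with h0 | hcpos
  · have hV0 := Matrix.fromBlocks_eq_zero_of_stationary hA hV hstat (by linarith)
    refine hZ0 (hZ.eq_zero_of_re_trace_mul_nonpos Matrix.PosDef.one ?_)
    rw [← Matrix.fromBlocks_one, trace_fromBlocks_mul_fromBlocks_diag, hV0]
    simp [← h0, ← hc]
  · have hscale : c⁻¹ • Matrix.fromBlocks X R Rᴴ W =
        Matrix.fromBlocks (c⁻¹ • X) (c⁻¹ • R) (c⁻¹ • R)ᴴ (c⁻¹ • W) := by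
      rw [Matrix.fromBlocks_smul, Matrix.conjTranspose_smul, star_trivial]
    have hci : 0 < c⁻¹ := inv_pos.2 hcpos
    have hmem := mem_relaxationValues (S := S) (k := k) (X := c⁻¹ • X) (R := c⁻¹ • R)
      (W := c⁻¹ • W) (by
        rw [← hscale, Matrix.mul_smul, Matrix.smul_mul, ← hstat])
      (by
        rw [Matrix.trace_smul, RCLike.smul_re, inv_mul_le_iff₀ hcpos, mul_one]
        exact htr)
      (by
        simp only [Matrix.smul_apply, norm_smul, Real.norm_of_nonneg hci.le, ← Finset.mul_sum]
        rw [inv_mul_le_iff₀ hcpos]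
        exact hsum)
      (by
        rw [← hscale]
        refine posSemidef_iff_reDot.2 ⟨?_, fun x => ?_⟩
        · rw [Matrix.IsHermitian, Matrix.conjTranspose_smul, hV.isHermitian.eq, star_trivial]
        · rw [reDot_mulVec_smul]
          exact mul_nonneg hci.le (hV.reDot_nonneg x))
    have h := hβ _ hmem
    rw [← hscale, Matrix.mul_smul, Matrix.trace_smul, RCLike.smul_re, inv_mul_lt_iff₀ hcpos,
      ← hobj] at h
    linarith

end StrongDuality

/-! ### The matrix inequalities as quadratic inequalities -/

section QuadraticInequalities

variable {𝕜 : Type*} [RCLike 𝕜]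

theorem Sum.elim_eq_zero_iff {a b R : Type*} [Zero R] {x : a → R} {y : b → R} :
    Sum.elim x y = 0 ↔ x = 0 ∧ y = 0 := by
  refine ⟨fun h => ⟨funext fun i => congrFun h (Sum.inl i), funext fun i => congrFun h (Sum.inr i)⟩,
    ?_⟩
  rintro ⟨rfl, rfl⟩
  ext (i | i) <;> rfl

theorem fromBlocks_mulVec_elim {a b c d : Type*} [Fintype a] [Fintype b]
    (A : Matrix c a 𝕜) (B : Matrix c b 𝕜) (C : Matrix d a 𝕜) (D : Matrix d b 𝕜)
    (x : a → 𝕜) (y : b → 𝕜) :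
    Matrix.fromBlocks A B C D *ᵥ Sum.elim x y =
      Sum.elim (A *ᵥ x + B *ᵥ y) (C *ᵥ x + D *ᵥ y) := by
  rw [Matrix.fromBlocks_mulVec, Sum.elim_comp_inl, Sum.elim_comp_inr]

theorem reDot_toBlocks₁₁ {a b : Type*} [Fintype a] [Fintype b] (M : Matrix (a ⊕ b) (a ⊕ b) 𝕜)
    (x y : a → 𝕜) :
    reDot (Sum.elim x 0) (M *ᵥ Sum.elim y 0) = reDot x (M.toBlocks₁₁ *ᵥ y) := by
  nth_rewrite 1 [← Matrix.fromBlocks_toBlocks M]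
  rw [fromBlocks_mulVec_elim, reDot_elim]
  simp

/-- Positivity of the compression is positivity on vectors whose first part lies in the kernel;
orthonormality of the columns serves only to make `N` injective. -/
theorem IsOrthonormalKernelBasis.posDef_neg_iff {a b c d : Type*} [Fintype a] [DecidableEq a]
    [Fintype c] [DecidableEq c] [Fintype d] [DecidableEq d] {L : Matrix b a 𝕜} {N : Matrix a c 𝕜}
    (hN : IsOrthonormalKernelBasis L N) {M : Matrix (a ⊕ d) (a ⊕ d) 𝕜} (hM : M.IsHermitian) :
    (-((Matrix.fromBlocks N 0 0 (1 : Matrix d d 𝕜))ᴴ * M *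
      Matrix.fromBlocks N 0 0 (1 : Matrix d d 𝕜))).PosDef ↔
      ∀ x w, L *ᵥ x = 0 → Sum.elim x w ≠ 0 →
        0 < -reDot (Sum.elim x w) (M *ᵥ Sum.elim x w) := by
  rw [posDef_iff_reDot]
  have hker : ∀ x, L *ᵥ x = 0 ↔ ∃ v, N *ᵥ v = x := fun x =>
    (SetLike.ext_iff.1 hN.range_eq_ker x).symm
  have hinj : ∀ v, N *ᵥ v = 0 → v = 0 := fun v hv => by
    rw [← Matrix.one_mulVec v, ← hN.orthonormal, ← Matrix.mulVec_mulVec, hv, Matrix.mulVec_zero]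
  have hform : ∀ v w, reDot (Sum.elim v w)
      (-((Matrix.fromBlocks N 0 0 (1 : Matrix d d 𝕜))ᴴ * M *
        Matrix.fromBlocks N 0 0 (1 : Matrix d d 𝕜)) *ᵥ Sum.elim v w) =
      -reDot (Sum.elim (N *ᵥ v) w) (M *ᵥ Sum.elim (N *ᵥ v) w) := fun v w => by
    rw [reDot_mulVec_neg, reDot_conj_mulVec, fromBlocks_mulVec_elim]
    simp
  constructor
  · rintro ⟨-, h⟩ x w hx hne
    obtain ⟨v, rfl⟩ := (hker x).1 hx
    have := h (Sum.elim v w) (fun h0 => hne (by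
      rw [Sum.elim_eq_zero_iff] at h0 ⊢
      rw [h0.1, Matrix.mulVec_zero]
      exact ⟨rfl, h0.2⟩))
    rwa [hform] at this
  · refine fun h => ⟨(Matrix.isHermitian_conjTranspose_mul_mul _ hM).neg, fun u hu => ?_⟩
    obtain ⟨v, w, rfl⟩ : ∃ v w, u = Sum.elim v w := ⟨_, _, (Sum.elim_comp_inl_inr u).symm⟩
    rw [hform]
    refine h _ _ ((hker _).2 ⟨v, rfl⟩) fun h0 => hu ?_
    rw [Sum.elim_eq_zero_iff] at h0 ⊢
    exact ⟨hinj v h0.1, h0.2⟩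

variable {n m r p q : Type*} [Fintype n] [Fintype m] [Fintype r] [Fintype p] [Fintype q]
variable [DecidableEq n] [DecidableEq m] [DecidableEq p]

theorem fromCols_mulVec_elim {a b c : Type*} [Fintype a] [Fintype b]
    (A : Matrix c a 𝕜) (B : Matrix c b 𝕜) (x : a → 𝕜) (y : b → 𝕜) :
    Matrix.fromCols A B *ᵥ Sum.elim x y = A *ᵥ x + B *ᵥ y := by
  rw [Matrix.fromCols_mulVec, Sum.elim_comp_inl, Sum.elim_comp_inr]

theorem reDot_mul_mul_mulVec {a b c d : Type*} [Fintype a] [Fintype b] [Fintype c] [Fintype d]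
    (E : Matrix a b 𝕜) (M : Matrix b c 𝕜) (F : Matrix c d 𝕜) (x : a → 𝕜) (y : d → 𝕜) :
    reDot x ((E * M * F) *ᵥ y) = reDot (Eᴴ *ᵥ x) (M *ᵥ (F *ᵥ y)) := by
  rw [← Matrix.mulVec_mulVec, ← Matrix.mulVec_mulVec, reDot_mulVec]

theorem reDot_conjTranspose_mulVec {a b : Type*} [Fintype a] [Fintype b]
    (M : Matrix a b 𝕜) (x : b → 𝕜) (y : a → 𝕜) :
    reDot x (Mᴴ *ᵥ y) = reDot y (M *ᵥ x) := by
  rw [reDot_mulVec, Matrix.conjTranspose_conjTranspose, reDot_comm]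

theorem Matrix.IsHermitian.real_smul_one (lam : ℝ) : (lam • (1 : Matrix m m 𝕜)).IsHermitian := by
  rw [Matrix.IsHermitian, Matrix.conjTranspose_smul, star_trivial, Matrix.conjTranspose_one]

theorem conjTranspose_mul_mul_of_isHermitian {a b : Type*} {Q : Matrix n n 𝕜}
    (hQ : Q.IsHermitian) (E : Matrix a n 𝕜) (F : Matrix n b 𝕜) :
    (E * Q * F)ᴴ = Fᴴ * Q * Eᴴ := by
  rw [Matrix.conjTranspose_mul, Matrix.conjTranspose_mul, hQ.eq, Matrix.mul_assoc]

/-- The matrix of the control inequality in the first semidefinite program. -/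
def controlMatrix (G : Plant 𝕜 n m r p q) (Q : Matrix n n 𝕜) (Y : Matrix m m 𝕜) (lam : ℝ) :
    Matrix ((n ⊕ p) ⊕ m) ((n ⊕ p) ⊕ m) 𝕜 :=
  Matrix.fromBlocks
      (Matrix.fromBlocks
        (G.A * Q * G.Aᴴ - Q) (G.A * Q * G.C₁ᴴ)
        (G.C₁ * Q * G.Aᴴ) (G.C₁ * Q * G.C₁ᴴ - 1))
      (Matrix.fromRows G.B₁ G.D₁₁)
      (Matrix.fromCols G.B₁ᴴ G.D₁₁ᴴ)
      (-(lam • (1 : Matrix m m 𝕜)) - Y)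

theorem isHermitian_controlMatrix (G : Plant 𝕜 n m r p q) {Q : Matrix n n 𝕜}
    (hQ : Q.IsHermitian) {Y : Matrix m m 𝕜} (hY : Y.IsHermitian) (lam : ℝ) :
    (controlMatrix G Q Y lam).IsHermitian := by
  refine Matrix.IsHermitian.fromBlocks (Matrix.IsHermitian.fromBlocks ?_ ?_ ?_) ?_ ?_
  · exact (Matrix.isHermitian_mul_mul_conjTranspose _ hQ).sub hQ
  · rw [conjTranspose_mul_mul_of_isHermitian hQ, Matrix.conjTranspose_conjTranspose]
  · exact (Matrix.isHermitian_mul_mul_conjTranspose _ hQ).sub Matrix.isHermitian_one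
  · rw [Matrix.conjTranspose_fromRows_eq_fromCols_conjTranspose]
  · exact (Matrix.IsHermitian.real_smul_one lam).neg.sub hY

/-- The matrix of the observation inequality in the first semidefinite program. -/
def observeMatrix (G : Plant 𝕜 n m r p q) (P : Matrix n n 𝕜) (Y : Matrix m m 𝕜) (lam : ℝ) :
    Matrix ((n ⊕ m) ⊕ p) ((n ⊕ m) ⊕ p) 𝕜 :=
  Matrix.fromBlocks
      (Matrix.fromBlocks
        (G.Aᴴ * P * G.A - P) (G.Aᴴ * P * G.B₁)
        (G.B₁ᴴ * P * G.A) (G.B₁ᴴ * P * G.B₁ - lam • (1 : Matrix m m 𝕜) - Y))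
      (Matrix.fromRows G.C₁ᴴ G.D₁₁ᴴ)
      (Matrix.fromCols G.C₁ G.D₁₁)
      (-1)

theorem isHermitian_observeMatrix (G : Plant 𝕜 n m r p q) {P : Matrix n n 𝕜}
    (hP : P.IsHermitian) {Y : Matrix m m 𝕜} (hY : Y.IsHermitian) (lam : ℝ) :
    (observeMatrix G P Y lam).IsHermitian := by
  refine Matrix.IsHermitian.fromBlocks (Matrix.IsHermitian.fromBlocks ?_ ?_ ?_) ?_ ?_
  · exact (Matrix.isHermitian_conjTranspose_mul_mul _ hP).sub hP
  · rw [conjTranspose_mul_mul_of_isHermitian hP, Matrix.conjTranspose_conjTranspose]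
  · exact ((Matrix.isHermitian_conjTranspose_mul_mul _ hP).sub
      (Matrix.IsHermitian.real_smul_one lam)).sub hY
  · rw [Matrix.conjTranspose_fromRows_eq_fromCols_conjTranspose,
      Matrix.conjTranspose_conjTranspose, Matrix.conjTranspose_conjTranspose]
  · exact Matrix.isHermitian_one.neg

theorem control_lmi_iff {c : Type*} [Fintype c] [DecidableEq c] {G : Plant 𝕜 n m r p q}
    {Nc : Matrix (n ⊕ p) c 𝕜}
    (hNc : IsOrthonormalKernelBasis (Matrix.fromCols G.B₂ᴴ G.D₁₂ᴴ) Nc)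
    {Q : Matrix n n 𝕜} (hQ : Q.IsHermitian) {Y : Matrix m m 𝕜} (hY : Y.IsHermitian) (lam : ℝ) :
    (-((Matrix.fromBlocks Nc 0 0 (1 : Matrix m m 𝕜))ᴴ * controlMatrix G Q Y lam * Matrix.fromBlocks Nc 0 0 (1 : Matrix m m 𝕜))).PosDef ↔
    ∀ a b w, G.B₂ᴴ *ᵥ a + G.D₁₂ᴴ *ᵥ b = 0 → Sum.elim (Sum.elim a b) w ≠ 0 →
      0 < reDot a (Q *ᵥ a) + reDot b b -
        reDot (G.Aᴴ *ᵥ a + G.C₁ᴴ *ᵥ b) (Q *ᵥ (G.Aᴴ *ᵥ a + G.C₁ᴴ *ᵥ b)) +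
        reDot w ((lam • (1 : Matrix m m 𝕜) + Y) *ᵥ w) +
        2 * (reDot a (G.B₁ *ᵥ w) + reDot b (G.D₁₁ *ᵥ w)) := by
  -- The sign of `w` is flipped so that the cross terms agree with those of `constructionMatrix`.
  have hform : ∀ a b w, -reDot (Sum.elim (Sum.elim a b) (-w))
      (controlMatrix G Q Y lam *ᵥ Sum.elim (Sum.elim a b) (-w)) =
      reDot a (Q *ᵥ a) + reDot b b -
        reDot (G.Aᴴ *ᵥ a + G.C₁ᴴ *ᵥ b) (Q *ᵥ (G.Aᴴ *ᵥ a + G.C₁ᴴ *ᵥ b)) +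
        reDot w ((lam • (1 : Matrix m m 𝕜) + Y) *ᵥ w) +
        2 * (reDot a (G.B₁ *ᵥ w) + reDot b (G.D₁₁ *ᵥ w)) := by
    intro a b w
    simp only [controlMatrix, fromBlocks_mulVec_elim, fromCols_mulVec_elim, Matrix.fromRows_mulVec,
      reDot_elim, reDot_add_right, Matrix.sub_mulVec, Matrix.neg_mulVec, Matrix.add_mulVec, Matrix.mulVec_add,
      Matrix.one_mulVec, reDot_sub_right, reDot_neg_right, reDot_neg_left, Matrix.mulVec_neg,
      reDot_mul_mul_mulVec, reDot_conjTranspose_mulVec, reDot_add_left]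
    ring
  rw [hNc.posDef_neg_iff]
  · constructor
    · intro h a b w hab hne
      rw [← hform]
      refine h _ _ (by rw [fromCols_mulVec_elim]; exact hab) fun h0 => hne ?_
      rw [Sum.elim_eq_zero_iff, neg_eq_zero] at h0
      rwa [Sum.elim_eq_zero_iff]
    · intro h x w hx hne
      obtain ⟨a, b, rfl⟩ : ∃ a b, x = Sum.elim a b := ⟨_, _, (Sum.elim_comp_inl_inr x).symm⟩
      rw [fromCols_mulVec_elim] at hx
      have h1 := h a b (-w) hx fun h0 => hne (by
        rw [Sum.elim_eq_zero_iff, neg_eq_zero] at h0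
        rwa [Sum.elim_eq_zero_iff])
      rwa [← hform, neg_neg] at h1
  · exact isHermitian_controlMatrix G hQ hY lam

theorem observe_lmi_iff {c : Type*} [Fintype c] [DecidableEq c] {G : Plant 𝕜 n m r p q}
    {No : Matrix (n ⊕ m) c 𝕜}
    (hNo : IsOrthonormalKernelBasis (Matrix.fromCols G.C₂ G.D₂₁) No)
    {P : Matrix n n 𝕜} (hP : P.IsHermitian) {Y : Matrix m m 𝕜} (hY : Y.IsHermitian) (lam : ℝ) :
    (-((Matrix.fromBlocks No 0 0 (1 : Matrix p p 𝕜))ᴴ * observeMatrix G P Y lam * Matrix.fromBlocks No 0 0 (1 : Matrix p p 𝕜))).PosDef ↔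
    ∀ x w z, G.C₂ *ᵥ x + G.D₂₁ *ᵥ w = 0 → Sum.elim (Sum.elim x w) z ≠ 0 →
      0 < reDot x (P *ᵥ x) - reDot (G.A *ᵥ x + G.B₁ *ᵥ w) (P *ᵥ (G.A *ᵥ x + G.B₁ *ᵥ w)) +
        reDot w ((lam • (1 : Matrix m m 𝕜) + Y) *ᵥ w) + reDot z z +
        2 * reDot z (G.C₁ *ᵥ x + G.D₁₁ *ᵥ w) := by
  have hform : ∀ x w z, -reDot (Sum.elim (Sum.elim x w) (-z))
      (observeMatrix G P Y lam *ᵥ Sum.elim (Sum.elim x w) (-z)) =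
      reDot x (P *ᵥ x) - reDot (G.A *ᵥ x + G.B₁ *ᵥ w) (P *ᵥ (G.A *ᵥ x + G.B₁ *ᵥ w)) +
        reDot w ((lam • (1 : Matrix m m 𝕜) + Y) *ᵥ w) + reDot z z +
        2 * reDot z (G.C₁ *ᵥ x + G.D₁₁ *ᵥ w) := by
    intro x w z
    simp only [observeMatrix, fromBlocks_mulVec_elim, fromCols_mulVec_elim, Matrix.fromRows_mulVec,
      reDot_elim, reDot_add_right, Matrix.sub_mulVec, Matrix.neg_mulVec, Matrix.add_mulVec, Matrix.mulVec_add,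
      Matrix.one_mulVec, reDot_sub_right, reDot_neg_right, reDot_neg_left, Matrix.mulVec_neg,
      reDot_mul_mul_mulVec, reDot_conjTranspose_mulVec, reDot_add_left,
      Matrix.conjTranspose_conjTranspose]
    ring
  rw [hNo.posDef_neg_iff]
  · constructor
    · intro h x w z hxw hne
      rw [← hform]
      refine h _ _ (by rw [fromCols_mulVec_elim]; exact hxw) fun h0 => hne ?_
      rw [Sum.elim_eq_zero_iff, neg_eq_zero] at h0
      rwa [Sum.elim_eq_zero_iff]
    · intro h y z hy hne
      obtain ⟨x, w, rfl⟩ : ∃ x w, y = Sum.elim x w := ⟨_, _, (Sum.elim_comp_inl_inr y).symm⟩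
      rw [fromCols_mulVec_elim] at hy
      have h1 := h x w (-z) hy fun h0 => hne (by
        rw [Sum.elim_eq_zero_iff, neg_eq_zero] at h0
        rwa [Sum.elim_eq_zero_iff])
      rwa [← hform, neg_neg] at h1
  · exact isHermitian_observeMatrix G hP hY lam

/-! ### The Schur complement of the dissipation inequality -/

/-- The matrix of the second semidefinite program, for a system `S`. -/
def constructionMatrix (S : StateSpace 𝕜 n m p) (P : Matrix n n 𝕜) (L : Matrix m m 𝕜) :
    Matrix ((n ⊕ p) ⊕ (n ⊕ m)) ((n ⊕ p) ⊕ (n ⊕ m)) 𝕜 :=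
  Matrix.fromBlocks
    (Matrix.fromBlocks P⁻¹ 0 0 (1 : Matrix p p 𝕜))
    (Matrix.fromBlocks S.A S.B S.C S.D)
    (Matrix.fromBlocks S.Aᴴ S.Cᴴ S.Bᴴ S.Dᴴ)
    (Matrix.fromBlocks P 0 0 L)

theorem reDot_constructionMatrix (S : StateSpace 𝕜 n m p) (P : Matrix n n 𝕜) (L : Matrix m m 𝕜)
    (a : n → 𝕜) (b : p → 𝕜) (x : n → 𝕜) (w : m → 𝕜) :
    reDot (Sum.elim (Sum.elim a b) (Sum.elim x w))
      (constructionMatrix S P L *ᵥ Sum.elim (Sum.elim a b) (Sum.elim x w)) =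
      reDot a (P⁻¹ *ᵥ a) + reDot b b + reDot x (P *ᵥ x) + reDot w (L *ᵥ w) +
        2 * (reDot a (S.A *ᵥ x + S.B *ᵥ w) + reDot b (S.C *ᵥ x + S.D *ᵥ w)) := by
  simp only [constructionMatrix, fromBlocks_mulVec_elim, reDot_elim, reDot_add_right,
    Matrix.zero_mulVec, reDot_zero_right, Matrix.one_mulVec, reDot_conjTranspose_mulVec]
  ring

theorem isHermitian_constructionMatrix (S : StateSpace 𝕜 n m p) {P : Matrix n n 𝕜}
    {L : Matrix m m 𝕜} (hP : P.IsHermitian) (hL : L.IsHermitian) :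
    (constructionMatrix S P L).IsHermitian :=
  Matrix.IsHermitian.fromBlocks
    (Matrix.IsHermitian.fromBlocks hP.inv (by simp) Matrix.isHermitian_one)
    (Matrix.fromBlocks_conjTranspose _ _ _ _)
    (Matrix.IsHermitian.fromBlocks hP (by simp) hL)

theorem reDot_add_add {a : Type*} [Fintype a] (x y : a → 𝕜) :
    reDot (x + y) (x + y) = reDot x x + 2 * reDot x y + reDot y y := by
  rw [reDot_add_left, reDot_add_right, reDot_add_right, reDot_comm y x]
  ring

theorem Sum.exists_elim_elim {a b c d R : Type*} (u : (a ⊕ b) ⊕ (c ⊕ d) → R) :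
    ∃ x y z w, u = Sum.elim (Sum.elim x y) (Sum.elim z w) :=
  ⟨_, _, _, _, by
    rw [Sum.elim_comp_inl_inr, Sum.elim_comp_inl_inr, Sum.elim_comp_inl_inr]⟩

theorem reDot_dissipation (S : StateSpace 𝕜 n m p) (P : Matrix n n 𝕜) (Y : Matrix m m 𝕜)
    (lam : ℝ) (x : n → 𝕜) (w : m → 𝕜) :
    reDot (Sum.elim x w) (dissipation S P Y lam *ᵥ Sum.elim x w) =
      reDot x (P *ᵥ x) + reDot w ((lam • (1 : Matrix m m 𝕜) + Y) *ᵥ w) -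
        reDot (S.A *ᵥ x + S.B *ᵥ w) (P *ᵥ (S.A *ᵥ x + S.B *ᵥ w)) -
        reDot (S.C *ᵥ x + S.D *ᵥ w) (S.C *ᵥ x + S.D *ᵥ w) := by
  rw [dissipation_eq, reDot_mulVec_sub, reDot_mulVec_sub, fromBlocks_mulVec_elim, reDot_elim,
    reDot_conj_mulVec, ← Matrix.mulVec_mulVec, reDot_mulVec _ (Matrix.fromCols S.C S.D)ᴴ,
    Matrix.conjTranspose_conjTranspose, fromCols_mulVec_elim, fromCols_mulVec_elim]
  simp

/-- A Schur complement: minimizing the form over `(a, b)` leaves the dissipation form in `(x, w)`.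
-/
theorem posDef_constructionMatrix_iff (S : StateSpace 𝕜 n m p) {P : Matrix n n 𝕜}
    (hP : P.PosDef) {Y : Matrix m m 𝕜} (hY : Y.IsHermitian) (lam : ℝ) :
    (constructionMatrix S P (lam • (1 : Matrix m m 𝕜) + Y)).PosDef ↔
      (dissipation S P Y lam).PosDef := by
  rw [posDef_iff_reDot, posDef_iff_reDot, and_iff_right (isHermitian_constructionMatrix S
    hP.isHermitian ((Matrix.IsHermitian.real_smul_one lam).add hY)),
    and_iff_right (isHermitian_dissipation S hP.isHermitian hY lam)]
  constructor
  · intro h v hv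
    obtain ⟨x, w, rfl⟩ : ∃ x w, v = Sum.elim x w := ⟨_, _, (Sum.elim_comp_inl_inr v).symm⟩
    -- The vector `(a, b)` is the minimizer for given `(x, w)`.
    have h1 := h (Sum.elim (Sum.elim (-(P *ᵥ (S.A *ᵥ x + S.B *ᵥ w))) (-(S.C *ᵥ x + S.D *ᵥ w)))
      (Sum.elim x w)) (fun h0 => hv (Sum.elim_eq_zero_iff.1 h0).2)
    have h2 : P⁻¹ *ᵥ (P *ᵥ (S.A *ᵥ x + S.B *ᵥ w)) = S.A *ᵥ x + S.B *ᵥ w := by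
      have := hP.inv.mulVec_inv_mulVec (S.A *ᵥ x + S.B *ᵥ w)
      rwa [hP.inv_inv] at this
    rw [reDot_constructionMatrix, Matrix.mulVec_neg, h2] at h1
    simp only [reDot_neg_left, reDot_neg_right] at h1
    rw [reDot_dissipation]
    rw [reDot_comm (P *ᵥ _)] at h1
    linarith
  · intro h v hv
    obtain ⟨a, b, x, w, rfl⟩ := Sum.exists_elim_elim v
    rw [reDot_constructionMatrix]
    have h1 := hP.inv.reDot_complete_square a (S.A *ᵥ x + S.B *ᵥ w)
    rw [hP.inv_inv] at h1
    have h2 := hP.inv.posSemidef.reDot_nonneg (a + P *ᵥ (S.A *ᵥ x + S.B *ᵥ w))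
    have h3 := reDot_self_nonneg (b + (S.C *ᵥ x + S.D *ᵥ w))
    rw [reDot_add_add] at h3
    rw [reDot_comm _ a] at h1
    by_cases hxw : Sum.elim x w = 0
    · obtain ⟨rfl, rfl⟩ := Sum.elim_eq_zero_iff.1 hxw
      simp only [Matrix.mulVec_zero, reDot_zero_right, add_zero, mul_zero]
      by_cases ha : a = 0
      · have hb : b ≠ 0 := by
          rintro rfl
          exact hv (by rw [Sum.elim_eq_zero_iff, Sum.elim_eq_zero_iff]; exact ⟨⟨ha, rfl⟩, hxw⟩)
        have := reDot_self_pos hb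
        have := hP.inv.posSemidef.reDot_nonneg a
        linarith
      · have := hP.inv.reDot_pos ha
        have := reDot_self_nonneg b
        linarith
    · have h4 := h _ hxw
      rw [reDot_dissipation] at h4
      linarith

end QuadraticInequalities

/-! ### Elimination and reconstruction of the controller -/

section Synthesis

variable {𝕜 : Type*} [RCLike 𝕜]
variable {n ν m r p q : Type*}
variable [Fintype n] [Fintype ν] [Fintype m] [Fintype r] [Fintype p] [Fintype q]
variable [DecidableEq n] [DecidableEq ν] [DecidableEq m] [DecidableEq p]

theorem closedLoop_state (G : Plant 𝕜 n m r p q) (K : Controller 𝕜 ν r q)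
    (x : n → 𝕜) (ζ : ν → 𝕜) (w : m → 𝕜) :
    (closedLoop G K).A *ᵥ Sum.elim x ζ + (closedLoop G K).B *ᵥ w =
      Sum.elim
        (G.A *ᵥ x + G.B₁ *ᵥ w + G.B₂ *ᵥ (K.CK *ᵥ ζ + K.DK *ᵥ (G.C₂ *ᵥ x + G.D₂₁ *ᵥ w)))
        (K.AK *ᵥ ζ + K.BK *ᵥ (G.C₂ *ᵥ x + G.D₂₁ *ᵥ w)) := by
  rw [closedLoop, fromBlocks_mulVec_elim, Matrix.fromRows_mulVec]
  simp only [Matrix.add_mulVec, Matrix.mulVec_add, ← Matrix.mulVec_mulVec]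
  ext (i | i) <;> simp only [Pi.add_apply, Sum.elim_inl, Sum.elim_inr] <;> ring

theorem closedLoop_output (G : Plant 𝕜 n m r p q) (K : Controller 𝕜 ν r q)
    (x : n → 𝕜) (ζ : ν → 𝕜) (w : m → 𝕜) :
    (closedLoop G K).C *ᵥ Sum.elim x ζ + (closedLoop G K).D *ᵥ w =
      G.C₁ *ᵥ x + G.D₁₁ *ᵥ w + G.D₁₂ *ᵥ (K.CK *ᵥ ζ + K.DK *ᵥ (G.C₂ *ᵥ x + G.D₂₁ *ᵥ w)) := by
  rw [closedLoop, fromCols_mulVec_elim]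
  simp only [Matrix.add_mulVec, Matrix.mulVec_add, ← Matrix.mulVec_mulVec]
  ext i
  simp only [Pi.add_apply]
  ring

theorem reDot_constructionMatrix_closedLoop (G : Plant 𝕜 n m r p q) (K : Controller 𝕜 ν r q)
    (Pcl : Matrix (n ⊕ ν) (n ⊕ ν) 𝕜) (L : Matrix m m 𝕜)
    (a : n → 𝕜) (a' : ν → 𝕜) (b : p → 𝕜) (x : n → 𝕜) (ζ : ν → 𝕜) (w : m → 𝕜) :
    reDot (Sum.elim (Sum.elim (Sum.elim a a') b) (Sum.elim (Sum.elim x ζ) w))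
      (constructionMatrix (closedLoop G K) Pcl L *ᵥ
        Sum.elim (Sum.elim (Sum.elim a a') b) (Sum.elim (Sum.elim x ζ) w)) =
      reDot (Sum.elim a a') (Pcl⁻¹ *ᵥ Sum.elim a a') + reDot b b +
        reDot (Sum.elim x ζ) (Pcl *ᵥ Sum.elim x ζ) + reDot w (L *ᵥ w) +
        2 * (reDot a (G.A *ᵥ x + G.B₁ *ᵥ w) + reDot b (G.C₁ *ᵥ x + G.D₁₁ *ᵥ w)) +
        2 * (reDot a' (K.AK *ᵥ ζ + K.BK *ᵥ (G.C₂ *ᵥ x + G.D₂₁ *ᵥ w)) +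
          reDot (G.B₂ᴴ *ᵥ a + G.D₁₂ᴴ *ᵥ b)
            (K.CK *ᵥ ζ + K.DK *ᵥ (G.C₂ *ᵥ x + G.D₂₁ *ᵥ w))) := by
  rw [reDot_constructionMatrix, closedLoop_state, closedLoop_output, reDot_elim,
    reDot_add_right a (G.A *ᵥ x + G.B₁ *ᵥ w), reDot_add_right b (G.C₁ *ᵥ x + G.D₁₁ *ᵥ w),
    reDot_mulVec a G.B₂, reDot_mulVec b G.D₁₂, reDot_add_left]
  ring

theorem mulVec_elim_zero {M : Matrix (n ⊕ ν) (n ⊕ ν) 𝕜} (x : n → 𝕜) :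
    M *ᵥ Sum.elim x 0 = Sum.elim (M.toBlocks₁₁ *ᵥ x) (M.toBlocks₂₁ *ᵥ x) := by
  nth_rewrite 1 [← Matrix.fromBlocks_toBlocks M]
  rw [fromBlocks_mulVec_elim]
  simp

theorem Matrix.PosDef.inv_mulVec_mulVec {M : Matrix n n 𝕜} (hM : M.PosDef)
    (x : n → 𝕜) : M⁻¹ *ᵥ (M *ᵥ x) = x := by
  have := hM.inv.mulVec_inv_mulVec x
  rwa [hM.inv_inv] at this

theorem exists_pos_posDef_of_continuous {F : ℝ → Matrix n n 𝕜} (hF : Continuous F)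
    (h0 : (F 0).PosDef) (hH : ∀ ε, (F ε).IsHermitian) : ∃ ε : ℝ, 0 < ε ∧ (F ε).PosDef := by
  have hev : ∀ᶠ ε in nhds (0 : ℝ), ∀ x, x ≠ 0 → 0 < reDot x (F ε *ᵥ x) :=
    hF.continuousAt.eventually_mem (isOpen_setOf_reDot_pos.mem_nhds (posDef_iff_reDot.1 h0).2)
  obtain ⟨ε, hpos, hε⟩ := ((hev.filter_mono nhdsWithin_le_nhds).and
    (self_mem_nhdsWithin (a := (0 : ℝ)) (s := Set.Ioi 0))).exists
  exact ⟨ε, hε, posDef_iff_reDot.2 ⟨hH ε, hpos⟩⟩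

/-- Elimination of the controller. -/
theorem exists_PQFeasible_of_posDef {cc co : Type*} [Fintype cc] [DecidableEq cc] [Fintype co]
    [DecidableEq co] {G : Plant 𝕜 n m r p q} {Nc : Matrix (n ⊕ p) cc 𝕜}
    {No : Matrix (n ⊕ m) co 𝕜}
    (hNc : IsOrthonormalKernelBasis (Matrix.fromCols G.B₂ᴴ G.D₁₂ᴴ) Nc)
    (hNo : IsOrthonormalKernelBasis (Matrix.fromCols G.C₂ G.D₂₁) No)
    {K : Controller 𝕜 ν r q} {Pcl : Matrix (n ⊕ ν) (n ⊕ ν) 𝕜} (hPcl : Pcl.PosDef)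
    {Y : Matrix m m 𝕜} {lam t : ℝ} (hY : SparsityConstraints Y lam t)
    (h : (constructionMatrix (closedLoop G K) Pcl (lam • (1 : Matrix m m 𝕜) + Y)).PosDef) :
    ∃ P Q, PQFeasible G Nc No P Q Y lam t := by
  have hP : Pcl.toBlocks₁₁.PosDef := hPcl.submatrix Sum.inl_injective
  have hQ : Pcl⁻¹.toBlocks₁₁.PosDef := hPcl.inv.submatrix Sum.inl_injective
  set P := Pcl.toBlocks₁₁
  set Q := Pcl⁻¹.toBlocks₁₁
  have hcontrol := (control_lmi_iff hNc hQ.isHermitian hY.isHermitian lam).2 (by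
    intro a b w hab hne
    set η := G.Aᴴ *ᵥ a + G.C₁ᴴ *ᵥ b with hη
    -- On this vector all controller terms vanish, and the closed-loop state is the minimizer
    -- `-P_cl⁻¹ (η, 0)`.
    have h1 := h.reDot_pos (x := Sum.elim (Sum.elim (Sum.elim a 0) b)
      (Sum.elim (Sum.elim (-(Q *ᵥ η)) (-(Pcl⁻¹.toBlocks₂₁ *ᵥ η))) w)) (fun h0 => hne (by
        simp only [Sum.elim_eq_zero_iff] at h0 ⊢
        exact ⟨⟨h0.1.1.1, h0.1.2⟩, h0.2.2⟩))
    have h2 : Sum.elim (-(Q *ᵥ η)) (-(Pcl⁻¹.toBlocks₂₁ *ᵥ η)) =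
        -(Pcl⁻¹ *ᵥ Sum.elim η (0 : ν → 𝕜)) := by
      rw [mulVec_elim_zero]
      ext (i | i) <;> rfl
    have h3 : reDot η (Q *ᵥ η) = reDot a (G.A *ᵥ (Q *ᵥ η)) + reDot b (G.C₁ *ᵥ (Q *ᵥ η)) := by
      rw [reDot_mulVec a, reDot_mulVec b, ← reDot_add_left]
    rw [reDot_constructionMatrix_closedLoop, hab, h2, Matrix.mulVec_neg, hPcl.mulVec_inv_mulVec,
      reDot_neg_left, reDot_neg_right, reDot_comm (Pcl⁻¹ *ᵥ _), reDot_toBlocks₁₁,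
      reDot_toBlocks₁₁] at h1
    simp only [reDot_zero_left, reDot_add_right, Matrix.mulVec_neg, reDot_neg_right] at h1
    simp only [add_zero] at h1
    linarith)
  have hobserve : ∀ x w z, G.C₂ *ᵥ x + G.D₂₁ *ᵥ w = 0 → Sum.elim (Sum.elim x w) z ≠ 0 →
      0 < reDot x (P *ᵥ x) - reDot (G.A *ᵥ x + G.B₁ *ᵥ w) (P *ᵥ (G.A *ᵥ x + G.B₁ *ᵥ w)) +
        reDot w ((lam • (1 : Matrix m m 𝕜) + Y) *ᵥ w) + reDot z z +
        2 * reDot z (G.C₁ *ᵥ x + G.D₁₁ *ᵥ w) := by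
    intro x w z hxw hne
    set τ := G.A *ᵥ x + G.B₁ *ᵥ w
    -- Dually, the controller sees no state and no measurement, and the costate is the minimizer
    -- `-P_cl (τ, 0)`.
    have h1 := h.reDot_pos (x := Sum.elim (Sum.elim (Sum.elim (-(P *ᵥ τ))
      (-(Pcl.toBlocks₂₁ *ᵥ τ))) z) (Sum.elim (Sum.elim x 0) w)) (fun h0 => hne (by
        simp only [Sum.elim_eq_zero_iff] at h0 ⊢
        exact ⟨⟨h0.2.1.1, h0.2.2⟩, h0.1.2⟩))
    have h2 : Sum.elim (-(P *ᵥ τ)) (-(Pcl.toBlocks₂₁ *ᵥ τ)) =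
        -(Pcl *ᵥ Sum.elim τ (0 : ν → 𝕜)) := by
      rw [mulVec_elim_zero]
      ext (i | i) <;> rfl
    rw [reDot_constructionMatrix_closedLoop, hxw, h2, Matrix.mulVec_neg, hPcl.inv_mulVec_mulVec,
      reDot_neg_left, reDot_neg_right, reDot_comm (Pcl *ᵥ _), reDot_toBlocks₁₁,
      reDot_toBlocks₁₁] at h1
    simp only [Matrix.mulVec_zero, add_zero, reDot_zero_right, mul_zero, reDot_neg_left,
      reDot_comm (P *ᵥ τ)] at h1
    linarith
  -- The leading blocks satisfy the coupling condition only weakly in general. Adding `ε` to `P`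
  -- makes it strict; the observation inequality is open, and the control inequality does not
  -- involve `P`.
  obtain ⟨ε, hε, hobs⟩ := exists_pos_posDef_of_continuous
    (F := fun ε : ℝ => -((Matrix.fromBlocks No 0 0 (1 : Matrix p p 𝕜))ᴴ *
      observeMatrix G (P + ε • 1) Y lam * Matrix.fromBlocks No 0 0 (1 : Matrix p p 𝕜)))
    (by
      unfold observeMatrix
      fun_prop)
    (by
      rw [zero_smul, add_zero]
      exact (observe_lmi_iff hNo hP.isHermitian hY.isHermitian lam).2 hobserve)
    (fun ε => (Matrix.isHermitian_conjTranspose_mul_mul _ (isHermitian_observeMatrix G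
      (hP.isHermitian.add (Matrix.IsHermitian.real_smul_one ε)) hY.isHermitian lam)).neg)
  refine ⟨P + ε • 1, Q, hY, ?_, hcontrol, hobs⟩
  refine posDef_iff_reDot.2 ⟨Matrix.IsHermitian.fromBlocks
    (hP.isHermitian.add (Matrix.IsHermitian.real_smul_one ε)) Matrix.conjTranspose_one
    hQ.isHermitian, fun u hu => ?_⟩
  obtain ⟨x, y, rfl⟩ : ∃ x y, u = Sum.elim x y := ⟨_, _, (Sum.elim_comp_inl_inr u).symm⟩
  have h1 := hPcl.reDot_complete_square (Sum.elim x 0) (Sum.elim y 0)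
  rw [reDot_toBlocks₁₁, reDot_toBlocks₁₁, reDot_elim, reDot_zero_left, add_zero] at h1
  have h2 := hPcl.posSemidef.reDot_nonneg (Sum.elim x 0 + Pcl⁻¹ *ᵥ Sum.elim y 0)
  rw [fromBlocks_mulVec_elim, reDot_elim, Matrix.one_mulVec, Matrix.one_mulVec, reDot_add_right,
    reDot_add_right, reDot_mulVec_add, reDot_mulVec_smul, Matrix.one_mulVec, reDot_comm x y]
  by_cases hx : x = 0
  · have hy : y ≠ 0 := fun hy => hu (Sum.elim_eq_zero_iff.2 ⟨hx, hy⟩)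
    have := hQ.reDot_pos hy
    simpa [hx] using this
  · have := mul_pos hε (reDot_self_pos hx)
    linarith

end Synthesis

/-! ### Reconstruction of `P_cl` and of the controller -/

section Reconstruction

variable {𝕜 : Type*} [RCLike 𝕜]
variable {n ν m r p q : Type*}
variable [Fintype n] [Fintype ν] [Fintype m] [Fintype r] [Fintype p] [Fintype q]
variable [DecidableEq n] [DecidableEq ν] [DecidableEq m] [DecidableEq p]

theorem posSemidef_sub_inv_of_coupling {P Q : Matrix n n 𝕜}
    (h : (Matrix.fromBlocks P 1 1 Q).PosDef) : (P - Q⁻¹).PosSemidef := by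
  have hP : P.PosDef := h.submatrix Sum.inl_injective
  have hQ : Q.PosDef := h.submatrix Sum.inr_injective
  refine posSemidef_iff_reDot.2 ⟨hP.isHermitian.sub hQ.inv.isHermitian, fun x => ?_⟩
  have h1 := h.posSemidef.reDot_nonneg (Sum.elim x (-(Q⁻¹ *ᵥ x)))
  rw [fromBlocks_mulVec_elim, reDot_elim, Matrix.one_mulVec, Matrix.one_mulVec, Matrix.mulVec_neg,
    hQ.mulVec_inv_mulVec, reDot_add_right, reDot_neg_right, add_neg_cancel, reDot_zero_right] at h1
  rw [reDot_mulVec_sub]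
  linarith

/-- A square Gram factor is padded with zero rows; this is where the order bound on the controller
enters. -/
theorem Matrix.PosSemidef.exists_eq_conjTranspose_mul_of_le {d e : ℕ} (hde : d ≤ e)
    {M : Matrix (Fin d) (Fin d) 𝕜} (hM : M.PosSemidef) :
    ∃ L : Matrix (Fin e) (Fin d) 𝕜, M = Lᴴ * L := by
  obtain ⟨B, rfl⟩ := hM.exists_eq_conjTranspose_mul_self
  have hJ : ((1 : Matrix (Fin e) (Fin e) 𝕜).submatrix id (Fin.castLE hde))ᴴ *
      (1 : Matrix (Fin e) (Fin e) 𝕜).submatrix id (Fin.castLE hde) = 1 := by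
    rw [Matrix.conjTranspose_submatrix, Matrix.conjTranspose_one,
      ← Matrix.submatrix_mul _ _ _ _ _ Function.bijective_id, Matrix.mul_one,
      Matrix.submatrix_one _ (Fin.castLE_injective hde)]
  refine ⟨(1 : Matrix (Fin e) (Fin e) 𝕜).submatrix id (Fin.castLE hde) * B, ?_⟩
  rw [Matrix.conjTranspose_mul, Matrix.mul_assoc, ← Matrix.mul_assoc _ _ B, hJ, Matrix.one_mul]

theorem posDef_reconstructedPcl {P Q : Matrix n n 𝕜} (hP : P.IsHermitian) (hQ : Q.PosDef)
    {P₂ : Matrix ν n 𝕜} (h : P - Q⁻¹ = P₂ᴴ * P₂) : (reconstructedPcl P P₂).PosDef := by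
  refine posDef_iff_reDot.2 ⟨Matrix.IsHermitian.fromBlocks hP
    (Matrix.conjTranspose_conjTranspose _) Matrix.isHermitian_one, fun u hu => ?_⟩
  obtain ⟨x, y, rfl⟩ : ∃ x y, u = Sum.elim x y := ⟨_, _, (Sum.elim_comp_inl_inr u).symm⟩
  have h1 : reDot x (P *ᵥ x) = reDot x (Q⁻¹ *ᵥ x) + reDot (P₂ *ᵥ x) (P₂ *ᵥ x) := by
    rw [sub_eq_iff_eq_add.1 h, reDot_mulVec_add, ← Matrix.mulVec_mulVec,
      reDot_conjTranspose_mulVec]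
    ring
  have h2 := reDot_add_add y (P₂ *ᵥ x)
  have h3 := reDot_self_nonneg (y + P₂ *ᵥ x)
  rw [reconstructedPcl, fromBlocks_mulVec_elim, reDot_elim, reDot_add_right, reDot_add_right,
    reDot_conjTranspose_mulVec, Matrix.one_mulVec, h1]
  by_cases hx : x = 0
  · have hy : y ≠ 0 := fun hy => hu (Sum.elim_eq_zero_iff.2 ⟨hx, hy⟩)
    simpa [hx] using reDot_self_pos hy
  · have := hQ.inv.reDot_pos hx
    linarith

/-- The Schur complement of the identity block in `P_cl` is `P - P₂ᴴ P₂ = Q⁻¹`. -/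
theorem toBlocks₁₁_inv_reconstructedPcl {P Q : Matrix n n 𝕜} (hQ : Q.PosDef)
    {P₂ : Matrix ν n 𝕜} (h : P - Q⁻¹ = P₂ᴴ * P₂) : (reconstructedPcl P P₂)⁻¹.toBlocks₁₁ = Q := by
  have hQQ : Q⁻¹ * Q = 1 :=
    Matrix.nonsing_inv_mul _ ((Matrix.isUnit_iff_isUnit_det _).1 hQ.isUnit)
  have hinv : (reconstructedPcl P P₂)⁻¹ =
      Matrix.fromBlocks Q (-(Q * P₂ᴴ)) (-(P₂ * Q)) (1 + P₂ * Q * P₂ᴴ) := by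
    refine Matrix.inv_eq_right_inv ?_
    rw [reconstructedPcl, Matrix.fromBlocks_multiply, ← Matrix.fromBlocks_one,
      sub_eq_iff_eq_add.1 h]
    congr 1
    · rw [Matrix.add_mul, Matrix.mul_neg, hQQ, Matrix.mul_assoc]
      abel
    · rw [Matrix.mul_neg, ← Matrix.mul_assoc, Matrix.add_mul, hQQ, Matrix.mul_add,
        Matrix.mul_one, Matrix.add_mul, Matrix.one_mul]
      simp only [Matrix.mul_assoc]
      abel
    · rw [Matrix.one_mul]
      abel
    · rw [Matrix.one_mul, Matrix.mul_neg, ← Matrix.mul_assoc]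
      abel
  rw [hinv, Matrix.toBlocks_fromBlocks₁₁]

/-- The controller with vanishing matrices. -/
def zeroController (𝕜 ν r q : Type*) [Zero 𝕜] : Controller 𝕜 ν r q := ⟨0, 0, 0, 0⟩

/-- Existence of a controller by the projection lemma. -/
theorem PQFeasible.exists_constructionFeasible {cc co : Type*} [Fintype cc] [DecidableEq cc]
    [Fintype co] [DecidableEq co] {G : Plant 𝕜 n m r p q} {Nc : Matrix (n ⊕ p) cc 𝕜}
    {No : Matrix (n ⊕ m) co 𝕜}
    (hNc : IsOrthonormalKernelBasis (Matrix.fromCols G.B₂ᴴ G.D₁₂ᴴ) Nc)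
    (hNo : IsOrthonormalKernelBasis (Matrix.fromCols G.C₂ G.D₂₁) No)
    {P Q : Matrix n n 𝕜} {Y : Matrix m m 𝕜} {lam t : ℝ}
    (hPQ : PQFeasible G Nc No P Q Y lam t) {P₂ : Matrix ν n 𝕜} (h : P - Q⁻¹ = P₂ᴴ * P₂) :
    ∃ K : Controller 𝕜 ν r q, ConstructionFeasible G (reconstructedPcl P P₂) K Y lam t := by
  have hP : P.PosDef := hPQ.coupling.submatrix Sum.inl_injective
  have hQ : Q.PosDef := hPQ.coupling.submatrix Sum.inr_injective
  have hY := hPQ.sparsity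
  have hPcl := posDef_reconstructedPcl hP.isHermitian hQ h
  have hP11 : (reconstructedPcl P P₂).toBlocks₁₁ = P := Matrix.toBlocks_fromBlocks₁₁ _ _ _ _
  have hQ11 := toBlocks₁₁_inv_reconstructedPcl hQ h
  set Pcl := reconstructedPcl P P₂
  have hcontrol := (control_lmi_iff hNc hQ.isHermitian hY.isHermitian lam).1 hPQ.control_lmi
  have hobserve := (observe_lmi_iff hNo hP.isHermitian hY.isHermitian lam).1 hPQ.observe_lmi
  set Λ : Matrix m m 𝕜 := lam • (1 : Matrix m m 𝕜) + Y
  have hΛ : Λ.IsHermitian := (Matrix.IsHermitian.real_smul_one lam).add hY.isHermitian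
  -- The construction matrix is that of the zero controller plus `U Θ V` and its adjoint, where `Θ`
  -- collects the four controller matrices.
  set U : Matrix (((n ⊕ ν) ⊕ p) ⊕ ((n ⊕ ν) ⊕ m)) (ν ⊕ r) 𝕜 :=
    (Matrix.fromCols (Matrix.fromCols (Matrix.fromBlocks 0 1 G.B₂ᴴ 0)
      (Matrix.fromRows 0 G.D₁₂ᴴ)) 0)ᴴ with hU
  set V : Matrix (ν ⊕ q) (((n ⊕ ν) ⊕ p) ⊕ ((n ⊕ ν) ⊕ m)) 𝕜 :=
    Matrix.fromCols 0 (Matrix.fromCols (Matrix.fromBlocks 0 1 G.C₂ 0)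
      (Matrix.fromRows 0 G.D₂₁)) with hV
  have hUx : ∀ a a' b u, Uᴴ *ᵥ Sum.elim (Sum.elim (Sum.elim a a') b) u =
      Sum.elim a' (G.B₂ᴴ *ᵥ a + G.D₁₂ᴴ *ᵥ b) := by
    intro a a' b u
    rw [hU, Matrix.conjTranspose_conjTranspose]
    simp only [fromCols_mulVec_elim, fromBlocks_mulVec_elim, Matrix.fromRows_mulVec]
    ext (i | i) <;> simp
  have hVx : ∀ u x ζ w, V *ᵥ Sum.elim u (Sum.elim (Sum.elim x ζ) w) =
      Sum.elim ζ (G.C₂ *ᵥ x + G.D₂₁ *ᵥ w) := by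
    intro u x ζ w
    rw [hV]
    simp only [fromCols_mulVec_elim, fromBlocks_mulVec_elim, Matrix.fromRows_mulVec]
    ext (i | i) <;> simp
  have hsplit : ∀ u : ((n ⊕ ν) ⊕ p) ⊕ ((n ⊕ ν) ⊕ m) → 𝕜, ∃ a a' b x ζ w,
      u = Sum.elim (Sum.elim (Sum.elim a a') b) (Sum.elim (Sum.elim x ζ) w) := by
    intro u
    obtain ⟨α, b, ξ, w, rfl⟩ := Sum.exists_elim_elim u
    obtain ⟨a, a', rfl⟩ : ∃ a a', α = Sum.elim a a' := ⟨_, _, (Sum.elim_comp_inl_inr α).symm⟩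
    obtain ⟨x, ζ, rfl⟩ : ∃ x ζ, ξ = Sum.elim x ζ := ⟨_, _, (Sum.elim_comp_inl_inr ξ).symm⟩
    exact ⟨_, _, _, _, _, _, rfl⟩
  obtain ⟨Θ, hΘ⟩ := Matrix.exists_posDef_add_mul_mul (isHermitian_constructionMatrix
    (closedLoop G (zeroController 𝕜 ν r q)) hPcl.isHermitian hΛ) U V
    (by
      intro u hu hUu
      obtain ⟨a, a', b, x, ζ, w, rfl⟩ := hsplit u
      rw [hUx, Sum.elim_eq_zero_iff] at hUu
      obtain ⟨rfl, hab⟩ := hUu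
      rw [reDot_constructionMatrix_closedLoop, hab, reDot_toBlocks₁₁, hQ11]
      set η := G.Aᴴ *ᵥ a + G.C₁ᴴ *ᵥ b
      have h1 := hPcl.reDot_complete_square (Sum.elim x ζ) (Sum.elim η 0)
      rw [reDot_toBlocks₁₁, hQ11, reDot_elim, reDot_zero_left, add_zero] at h1
      have h2 : reDot η x = reDot a (G.A *ᵥ x) + reDot b (G.C₁ *ᵥ x) := by
        rw [reDot_mulVec a, reDot_mulVec b, ← reDot_add_left]
      simp only [reDot_zero_left, reDot_add_right, add_zero, mul_zero]
      -- The control inequality says nothing at `(a, b, w) = 0`; there only the form of `P_cl` in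
      -- `(x, ζ)` remains. Otherwise completing the square in `(x, ζ)` reduces to it.
      by_cases hne : Sum.elim (Sum.elim a b) w = 0
      · simp only [Sum.elim_eq_zero_iff] at hne
        obtain ⟨⟨rfl, rfl⟩, rfl⟩ := hne
        have hξ : Sum.elim x ζ ≠ 0 := fun h0 => hu (by
          rw [h0]; simp)
        simpa using hPcl.reDot_pos hξ
      · have h3 := hcontrol a b w hab hne
        have h4 := hPcl.posSemidef.reDot_nonneg (Sum.elim x ζ + Pcl⁻¹ *ᵥ Sum.elim η 0)
        linarith)
    (by
      intro u hu hVu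
      obtain ⟨a, a', b, x, ζ, w, rfl⟩ := hsplit u
      rw [hVx, Sum.elim_eq_zero_iff] at hVu
      obtain ⟨rfl, hxw⟩ := hVu
      rw [reDot_constructionMatrix_closedLoop, hxw, reDot_toBlocks₁₁, hP11]
      set τ := G.A *ᵥ x + G.B₁ *ᵥ w
      have h1 := hPcl.inv.reDot_complete_square (Sum.elim a a') (Sum.elim τ 0)
      rw [hPcl.inv_inv, reDot_toBlocks₁₁, hP11, reDot_elim, reDot_zero_left, add_zero,
        reDot_comm τ a] at h1
      simp only [Matrix.mulVec_zero, reDot_zero_right, add_zero, mul_zero]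
      by_cases hne : Sum.elim (Sum.elim x w) b = 0
      · simp only [Sum.elim_eq_zero_iff] at hne
        obtain ⟨⟨rfl, rfl⟩, rfl⟩ := hne
        have hξ : Sum.elim a a' ≠ 0 := fun h0 => hu (by
          rw [h0]; simp)
        simpa [τ] using hPcl.inv.reDot_pos hξ
      · have h3 := hobserve x w b hxw hne
        have h4 := hPcl.inv.posSemidef.reDot_nonneg (Sum.elim a a' + Pcl *ᵥ Sum.elim τ 0)
        linarith)
  set K : Controller 𝕜 ν r q := ⟨Θ.toBlocks₁₁, Θ.toBlocks₁₂, Θ.toBlocks₂₁, Θ.toBlocks₂₂⟩ with hK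
  refine ⟨K, hY, ?_⟩
  change (constructionMatrix (closedLoop G K) Pcl Λ).PosDef
  refine posDef_iff_reDot.2 ⟨isHermitian_constructionMatrix _ hPcl.isHermitian hΛ, fun u hu => ?_⟩
  have hpos := hΘ.reDot_pos hu
  obtain ⟨a, a', b, x, ζ, w, rfl⟩ := hsplit u
  have hUV : ∀ u, reDot u ((U * Θ * V) *ᵥ u) = reDot (Uᴴ *ᵥ u) (Θ *ᵥ (V *ᵥ u)) := fun u =>
    reDot_mul_mul_mulVec _ _ _ _ _
  rw [reDot_mulVec_add, reDot_mulVec_add, reDot_conjTranspose_mulVec, hUV, hUx, hVx,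
    ← Matrix.fromBlocks_toBlocks Θ, fromBlocks_mulVec_elim, reDot_elim,
    reDot_constructionMatrix_closedLoop] at hpos
  rw [reDot_constructionMatrix_closedLoop]
  simp only [zeroController, Matrix.zero_mulVec, add_zero, reDot_zero_right, mul_zero] at hpos
  linarith

end Reconstruction

/-! ### Norm bounds and comparison of the programs -/

section Optimization

variable {𝕜 : Type*} [RCLike 𝕜]
variable {n ν m r p q : Type*}
variable [Fintype n] [Fintype ν] [Fintype m] [Fintype r] [Fintype p] [Fintype q]
variable [DecidableEq n] [DecidableEq ν] [DecidableEq m] [DecidableEq p]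

theorem posDef_sub_of_posDef_dissipation {S : StateSpace 𝕜 n m p} {P : Matrix n n 𝕜}
    {Y : Matrix m m 𝕜} {lam : ℝ} (h : (dissipation S P Y lam).PosDef) :
    (P - S.Aᴴ * P * S.A).PosDef := by
  have h1 : (dissipation S P Y lam).toBlocks₁₁.PosDef := h.submatrix Sum.inl_injective
  have h2 := h1.add_posSemidef (Matrix.posSemidef_conjTranspose_mul_self S.C)
  have h3 : (dissipation S P Y lam).toBlocks₁₁ + S.Cᴴ * S.C = P - S.Aᴴ * P * S.A := by
    rw [dissipation, Matrix.fromBlocks_add, Matrix.fromBlocks_neg, Matrix.toBlocks_fromBlocks₁₁]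
    abel
  rwa [h3] at h2

theorem SynthesisFeasible.stabilizes {G : Plant 𝕜 n m r p q} {K : Controller 𝕜 ν r q}
    {Pcl : Matrix (n ⊕ ν) (n ⊕ ν) 𝕜} {Y : Matrix m m 𝕜} {lam t : ℝ}
    (h : SynthesisFeasible G K Pcl Y lam t) : Stabilizes G K :=
  isSchurStable_of_posDef h.Pcl_posDef (posDef_sub_of_posDef_dissipation h.lmi)

/-- A strict certificate with `Y = 0` bounds the values, and the value at `V = 0` makes the supremum
nonnegative, so squaring undoes the root. -/
theorem IsSchurStable.isLUB_relaxationValues {S : StateSpace 𝕜 n m p} (hA : IsSchurStable S.A)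
    (k : ℕ) : IsLUB (relaxationValues S k) (relaxedNorm S k ^ 2) := by
  obtain ⟨P, lam, -, hlam, hpos⟩ := hA.exists_posDef_dissipation
  have hbdd : BddAbove (relaxationValues S k) := ⟨_, fun v hv =>
    relaxationValues_le (sparsityConstraints_zero hlam) hpos hv⟩
  have hmem := zero_mem_relaxationValues S k
  rw [relaxedNorm, Real.sq_sqrt (le_csSup hbdd hmem)]
  exact isLUB_csSup ⟨0, hmem⟩ hbdd

theorem SynthesisFeasible.relaxedNorm_sq_le {G : Plant 𝕜 n m r p q} {K : Controller 𝕜 ν r q}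
    {Pcl : Matrix (n ⊕ ν) (n ⊕ ν) 𝕜} {Y : Matrix m m 𝕜} {lam t : ℝ}
    (h : SynthesisFeasible G K Pcl Y lam t) (k : ℕ) :
    relaxedNorm (closedLoop G K) k ^ 2 ≤ lam + k * t :=
  (h.stabilizes.isLUB_relaxationValues k).2 fun _ hv =>
    relaxationValues_le h.sparsity h.lmi hv

/-- Strong duality gives only a Hermitian `P`; stability of the closed loop upgrades it to a
positive definite one. -/
theorem Stabilizes.exists_synthesisFeasible_of_lt {G : Plant 𝕜 n m r p q}
    {K : Controller 𝕜 ν r q} (hK : Stabilizes G K) {k : ℕ} {β : ℝ}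
    (hβ : relaxedNorm (closedLoop G K) k ^ 2 < β) :
    ∃ Pcl Y lam t, SynthesisFeasible G K Pcl Y lam t ∧ lam + k * t < β := by
  obtain ⟨P, Y, lam, t, hP, hY, hpos, hlt⟩ := hK.exists_posDef_dissipation_of_lt
    (fun v hv => ((hK.isLUB_relaxationValues k).1 hv).trans_lt hβ)
  exact ⟨P, Y, lam, t,
    ⟨hY, hK.posDef_of_posDef hP (posDef_sub_of_posDef_dissipation hpos), hpos⟩, hlt⟩

theorem constructionFeasible_iff {G : Plant 𝕜 n m r p q} {K : Controller 𝕜 ν r q}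
    {Pcl : Matrix (n ⊕ ν) (n ⊕ ν) 𝕜} (hPcl : Pcl.PosDef) {Y : Matrix m m 𝕜} {lam t : ℝ} :
    ConstructionFeasible G Pcl K Y lam t ↔ SynthesisFeasible G K Pcl Y lam t :=
  ⟨fun h => ⟨h.sparsity, hPcl,
      (posDef_constructionMatrix_iff _ hPcl h.sparsity.isHermitian lam).1 h.lmi⟩,
    fun h => ⟨h.sparsity,
      (posDef_constructionMatrix_iff _ hPcl h.sparsity.isHermitian lam).2 h.lmi⟩⟩

theorem SynthesisFeasible.exists_PQFeasible {cc co : Type*} [Fintype cc] [DecidableEq cc]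
    [Fintype co] [DecidableEq co] {G : Plant 𝕜 n m r p q} {Nc : Matrix (n ⊕ p) cc 𝕜}
    {No : Matrix (n ⊕ m) co 𝕜}
    (hNc : IsOrthonormalKernelBasis (Matrix.fromCols G.B₂ᴴ G.D₁₂ᴴ) Nc)
    (hNo : IsOrthonormalKernelBasis (Matrix.fromCols G.C₂ G.D₂₁) No)
    {K : Controller 𝕜 ν r q} {Pcl : Matrix (n ⊕ ν) (n ⊕ ν) 𝕜} {Y : Matrix m m 𝕜} {lam t : ℝ}
    (h : SynthesisFeasible G K Pcl Y lam t) : ∃ P Q, PQFeasible G Nc No P Q Y lam t :=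
  exists_PQFeasible_of_posDef hNc hNo h.Pcl_posDef h.sparsity
    ((constructionFeasible_iff h.Pcl_posDef).2 h).lmi

end Optimization

end

/-! ### Main theorem -/

theorem mainTheorem6 {𝕜 : Type*} [RCLike 𝕜]
    (n m r p q nK k : ℕ) (hnK : n ≤ nK)
    (G : Plant 𝕜 (Fin n) (Fin m) (Fin r) (Fin p) (Fin q))
    (hG : IsStabilizable G)
    (cc co : ℕ)
    (Nc : Matrix (Fin n ⊕ Fin p) (Fin cc) 𝕜) (No : Matrix (Fin n ⊕ Fin m) (Fin co) 𝕜)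
    (hNc : IsOrthonormalKernelBasis (Matrix.fromCols G.B₂ᴴ G.D₁₂ᴴ) Nc)
    (hNo : IsOrthonormalKernelBasis (Matrix.fromCols G.C₂ G.D₂₁) No) :
    -- the relaxed norm of every stable closed loop is a genuine supremum
    (∀ K : Controller 𝕜 (Fin nK) (Fin r) (Fin q), Stabilizes G K →
      IsLUB (relaxationValues (closedLoop G K) k) (relaxedNorm (closedLoop G K) k ^ 2)) ∧
    -- the synthesis problem and the first program have the same feasible `(Y, λ, t)`
    (∀ (Y : Matrix (Fin m) (Fin m) 𝕜) (lam t : ℝ),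
      (∃ (K : Controller 𝕜 (Fin nK) (Fin r) (Fin q)) (Pcl : _),
        SynthesisFeasible G K Pcl Y lam t) ↔
      ∃ P Q, PQFeasible G Nc No P Q Y lam t) ∧
    ∃ γ : ℝ,
      -- `γ` is the optimal value of the three problems
      IsGLB {v : ℝ | ∃ K : Controller 𝕜 (Fin nK) (Fin r) (Fin q), Stabilizes G K ∧
        v = relaxedNorm (closedLoop G K) k ^ 2} γ ∧
      IsGLB {v : ℝ | ∃ (K : Controller 𝕜 (Fin nK) (Fin r) (Fin q)) (Pcl : _)
        (Y : _) (lam t : ℝ), SynthesisFeasible G K Pcl Y lam t ∧ v = lam + k * t} γ ∧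
      IsGLB {v : ℝ | ∃ (P Q : _) (Y : _) (lam t : ℝ),
        PQFeasible G Nc No P Q Y lam t ∧ v = lam + k * t} γ ∧
      -- reconstruction of `P_cl` and of the controller from a feasible point of the first program
      ∀ (P Q : Matrix (Fin n) (Fin n) 𝕜) (Y : Matrix (Fin m) (Fin m) 𝕜) (lam t : ℝ),
        PQFeasible G Nc No P Q Y lam t →
        (∃ P₂ : Matrix (Fin nK) (Fin n) 𝕜, P - Q⁻¹ = P₂ᴴ * P₂) ∧
        ∀ P₂ : Matrix (Fin nK) (Fin n) 𝕜, P - Q⁻¹ = P₂ᴴ * P₂ →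
          (reconstructedPcl P P₂).PosDef ∧
          (∃ K : Controller 𝕜 (Fin nK) (Fin r) (Fin q),
            ConstructionFeasible G (reconstructedPcl P P₂) K Y lam t) ∧
          (∃ δ : ℝ,
            IsGLB {v : ℝ | ∃ (K : Controller 𝕜 (Fin nK) (Fin r) (Fin q)) (Y' : _)
              (lam' t' : ℝ), ConstructionFeasible G (reconstructedPcl P P₂) K Y' lam' t' ∧
                v = lam' + k * t'} δ ∧
            γ ≤ δ ∧ δ ≤ lam + k * t) ∧
          ∀ (K : Controller 𝕜 (Fin nK) (Fin r) (Fin q)) (Y' : Matrix (Fin m) (Fin m) 𝕜)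
            (lam' t' : ℝ), ConstructionFeasible G (reconstructedPcl P P₂) K Y' lam' t' →
              Stabilizes G K ∧
              SynthesisFeasible G K (reconstructedPcl P P₂) Y' lam' t' ∧
              relaxedNorm (closedLoop G K) k ^ 2 ≤ lam' + k * t' := by
  classical
  have hrec : ∀ (P Q : Matrix (Fin n) (Fin n) 𝕜) (Y : Matrix (Fin m) (Fin m) 𝕜) (lam t : ℝ),
      PQFeasible G Nc No P Q Y lam t →
      (∃ P₂ : Matrix (Fin nK) (Fin n) 𝕜, P - Q⁻¹ = P₂ᴴ * P₂) ∧
      ∀ P₂ : Matrix (Fin nK) (Fin n) 𝕜, P - Q⁻¹ = P₂ᴴ * P₂ →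
        (reconstructedPcl P P₂).PosDef ∧
        ∃ K : Controller 𝕜 (Fin nK) (Fin r) (Fin q),
          ConstructionFeasible G (reconstructedPcl P P₂) K Y lam t :=
    fun P Q Y lam t h =>
      have hP : P.PosDef := h.coupling.submatrix Sum.inl_injective
      have hQ : Q.PosDef := h.coupling.submatrix Sum.inr_injective
      ⟨(posSemidef_sub_inv_of_coupling h.coupling).exists_eq_conjTranspose_mul_of_le hnK,
        fun P₂ hP₂ => ⟨posDef_reconstructedPcl hP.isHermitian hQ hP₂,
          h.exists_constructionFeasible hNc hNo hP₂⟩⟩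
  have hiff : ∀ (Y : Matrix (Fin m) (Fin m) 𝕜) (lam t : ℝ),
      (∃ (K : Controller 𝕜 (Fin nK) (Fin r) (Fin q)) (Pcl : _),
        SynthesisFeasible G K Pcl Y lam t) ↔
      ∃ P Q, PQFeasible G Nc No P Q Y lam t := by
    refine fun Y lam t => ⟨fun ⟨K, Pcl, h⟩ => h.exists_PQFeasible hNc hNo, ?_⟩
    rintro ⟨P, Q, h⟩
    obtain ⟨⟨P₂, hP₂⟩, hall⟩ := hrec P Q Y lam t h
    obtain ⟨hpos, K, hK⟩ := hall P₂ hP₂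
    exact ⟨K, _, (constructionFeasible_iff hpos).1 hK⟩
  obtain ⟨K₀, hK₀⟩ : ∃ K : Controller 𝕜 (Fin nK) (Fin r) (Fin q), Stabilizes G K := by
    -- The order `d` is unrelated to `nK`: eliminating this controller and reconstructing another
    -- changes the order. The cost bound is irrelevant, so the norm bound plus 1 serves.
    obtain ⟨d, K, hK⟩ := hG
    obtain ⟨Pcl, Y, lam, t, h, -⟩ := hK.exists_synthesisFeasible_of_lt (lt_add_one _) (k := k)
    obtain ⟨K', Pcl', h'⟩ := (hiff Y lam t).2 (h.exists_PQFeasible hNc hNo)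
    exact ⟨K', h'.stabilizes⟩
  set T : Set ℝ := {v : ℝ | ∃ K : Controller 𝕜 (Fin nK) (Fin r) (Fin q), Stabilizes G K ∧
    v = relaxedNorm (closedLoop G K) k ^ 2}
  have hT : IsGLB T (sInf T) := isGLB_csInf ⟨_, K₀, hK₀, rfl⟩
    ⟨0, by rintro _ ⟨K, -, rfl⟩; positivity⟩
  have hle : ∀ (K : Controller 𝕜 (Fin nK) (Fin r) (Fin q)) Pcl Y lam t,
      SynthesisFeasible G K Pcl Y lam t → sInf T ≤ lam + k * t := fun K Pcl Y lam t h =>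
    (hT.1 ⟨K, h.stabilizes, rfl⟩).trans (h.relaxedNorm_sq_le k)
  have hS : IsGLB {v : ℝ | ∃ (K : Controller 𝕜 (Fin nK) (Fin r) (Fin q)) (Pcl : _)
        (Y : _) (lam t : ℝ), SynthesisFeasible G K Pcl Y lam t ∧ v = lam + k * t} (sInf T) := by
    refine ⟨?_, fun x hx => hT.2 ?_⟩
    · rintro _ ⟨K, Pcl, Y, lam, t, h, rfl⟩
      exact hle K Pcl Y lam t h
    · rintro _ ⟨K, hK, rfl⟩
      refine le_of_forall_gt_imp_ge_of_dense fun β hβ => ?_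
      obtain ⟨Pcl, Y, lam, t, h, hlt⟩ := hK.exists_synthesisFeasible_of_lt hβ
      exact (hx ⟨K, Pcl, Y, lam, t, h, rfl⟩).trans hlt.le
  refine ⟨fun K hK => hK.isLUB_relaxationValues k, hiff, sInf T, hT, hS, ?_, ?_⟩
  -- The two sets of costs coincide, because the feasible triples `(Y, λ, t)` do.
  · convert hS using 1
    ext v
    constructor
    · rintro ⟨P, Q, Y, lam, t, h, rfl⟩
      obtain ⟨K, Pcl, h'⟩ := (hiff Y lam t).2 ⟨P, Q, h⟩
      exact ⟨K, Pcl, Y, lam, t, h', rfl⟩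
    · rintro ⟨K, Pcl, Y, lam, t, h, rfl⟩
      obtain ⟨P, Q, h'⟩ := (hiff Y lam t).1 ⟨K, Pcl, h⟩
      exact ⟨P, Q, Y, lam, t, h', rfl⟩
  · intro P Q Y lam t h
    obtain ⟨hex, hall⟩ := hrec P Q Y lam t h
    refine ⟨hex, fun P₂ hP₂ => ?_⟩
    obtain ⟨hpos, K, hK⟩ := hall P₂ hP₂
    set D : Set ℝ := {v : ℝ | ∃ (K : Controller 𝕜 (Fin nK) (Fin r) (Fin q))
        (Y' : _) (lam' t' : ℝ), ConstructionFeasible G (reconstructedPcl P P₂) K Y' lam' t' ∧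
          v = lam' + k * t'}
    have hlow : sInf T ∈ lowerBounds D := by
      rintro _ ⟨K', Y', lam', t', h', rfl⟩
      exact hle _ _ _ _ _ ((constructionFeasible_iff hpos).1 h')
    have hglb : IsGLB D (sInf D) := isGLB_csInf ⟨_, K, Y, lam, t, hK, rfl⟩ ⟨_, hlow⟩
    refine ⟨hpos, ⟨K, hK⟩, ⟨_, hglb, hglb.2 hlow, hglb.1 ⟨K, Y, lam, t, hK, rfl⟩⟩, ?_⟩
    intro K' Y' lam' t' h'
    have hsyn := (constructionFeasible_iff hpos).1 h'
    exact ⟨hsyn.stabilizes, hsyn, hsyn.relaxedNorm_sq_le k⟩
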